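/- **Theorem.** Let $q\in\mathbb{C}$ with $0<|q|<1$, and write $(z)_k=\prod_{j=0}^{k-1}(1-zq^j)$ for integers $k\ge 0$ and $(z)_\infty=\prod_{j=0}^{\infty}(1-zq^j)$; several arguments in one symbol denote a product, $(z_1,\dots,z_m)_\infty=(z_1)_\infty\cdots(z_m)_\infty$. For $\boldsymbol{k}=(k_1,\dots,k_n)$ put $|\boldsymbol{k}|=k_1+\cdots+k_n$. Let $\alpha,b,c,a_1,\dots,a_n,x_1,\dots,x_n\in\mathbb{C}$ be such that $$\left|\frac{\alpha a_1\cdots a_n bc}{q^{1+n}}\right|<1,$$ or such that $a_r=q^{N_r}$ with an integer $N_r\ge 1$ for every $r=1,\dots,n$ (so that the series below terminates). Suppose that none of the denominators in the following identity vanishes. Then the series on the right-hand side converges absolutely and $$\begin{aligned} &\frac{(\alpha bc/q,\ \alpha a_1\cdots a_n c\,q^{-n})_\infty}{(\alpha c,\ \alpha a_1\cdots a_n bc\,q^{-(1+n)})_\infty}\prod_{r=1}^{n}\frac{(\alpha q x_r,\ \alpha a_r b x_r/q)_\infty}{(\alpha b x_r,\ \alpha a_r x_r)_\infty}\\ &=\sum_{k_1,\dots,k_n\ge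 0}\ \prod_{1\le r<s\le n}\frac{1-q^{k_r-k_s}x_r/x_s}{1-x_r/x_s}\ \prod_{r,s=1}^{n}\frac{\left(q x_r/(x_s a_s)\right)_{k_r}}{\left(q x_r/x_s\right)_{k_r}}\\ &\quad\times\prod_{r=1}^{n}\frac{1-\alpha x_r q^{k_r+|\boldsymbol{k}|}}{1-\alpha x_r}\ \prod_{r=1}^{n}\frac{(\alpha x_r)_{|\boldsymbol{k}|}}{(\alpha x_r a_r)_{|\boldsymbol{k}|}}\ q^{\sum_{r=1}^{n}(r-1)k_r}\\ &\quad\times\frac{(q/b)_{|\boldsymbol{k}|}}{(\alpha c)_{|\boldsymbol{k}|}}\ \prod_{r=1}^{n}\frac{(q x_r/c)_{k_r}}{(\alpha b x_r)_{k_r}}\ \left(\frac{\alpha a_1\cdots a_n bc}{q^{1+n}}\right)^{|\boldsymbol{k}|}. \end{aligned}$$ -/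

import Mathlib

/-- The `q`-shifted factorial `(z; q)_k = ∏_{j < k} (1 - z q ^ j)`. -/
def qShifted (q z : ℂ) (k : ℕ) : ℂ :=
  ∏ j ∈ Finset.range k, (1 - z * q ^ j)

/-- The infinite `q`-shifted factorial `(z; q)_∞ = ∏_{j ≥ 0} (1 - z q ^ j)`
(the product converges absolutely for `‖q‖ < 1`). -/
noncomputable def qShiftedInf (q z : ℂ) : ℂ :=
  ∏' j : ℕ, (1 - z * q ^ j)

/-- The factor `∏_{r < s} (1 - q ^ (k_r - k_s) x_r / x_s) / (1 - x_r / x_s)` that is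
characteristic of `A_n` basic hypergeometric series. -/
noncomputable def vandermondeFactor {n : ℕ} (q : ℂ) (x : Fin n → ℂ) (k : Fin n → ℕ) : ℂ :=
  ∏ r : Fin n, ∏ s ∈ Finset.Ioi r,
    (1 - q ^ ((k r : ℤ) - (k s : ℤ)) * (x r / x s)) / (1 - x r / x s)

/-- The argument `α a_1 ⋯ a_n b c / q ^ (1 + n)` of the series. -/
noncomputable def rogersArg {n : ℕ} (q α b c : ℂ) (a : Fin n → ℂ) : ℂ :=
  α * (∏ r, a r) * b * c / q ^ (1 + n)

/-- The summand of the `A_n` very-well-poised `6φ5` series at the multi-index `k`.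
The indices `r : Fin n` start at `0`, so that the exponent `∑ (r - 1) k_r` of the usual
`1`-based indexing becomes `∑ r k_r`. -/
noncomputable def rogersTerm {n : ℕ} (q α b c : ℂ) (x a : Fin n → ℂ) (k : Fin n → ℕ) : ℂ :=
  vandermondeFactor q x k
    * (∏ r, ∏ s, qShifted q (q * x r / (x s * a s)) (k r) / qShifted q (q * x r / x s) (k r))
    * (∏ r, (1 - α * x r * q ^ (k r + ∑ i, k i)) / (1 - α * x r))
    * (∏ r, qShifted q (α * x r) (∑ i, k i) / qShifted q (α * x r * a r) (∑ i, k i))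
    * q ^ (∑ r : Fin n, (r : ℕ) * k r)
    * (qShifted q (q / b) (∑ i, k i) / qShifted q (α * c) (∑ i, k i))
    * (∏ r, qShifted q (q * x r / c) (k r) / qShifted q (α * b * x r) (k r))
    * rogersArg q α b c a ^ (∑ i, k i)

open Finset Filter Topology

/-! ### Finite and infinite `q`-shifted factorials -/

section QShifted

/-! Put `y_r = a_r x_r`. The factors `(q x_r / (x_s a_s))_{k_r}` and `(q x_r / c)_{k_r}`, together
with the power of the argument, become homogeneous polynomials in the `y_s` and in `c`, and the
summand turns out to be symmetric under exchanging `c` with any `y_s` (`symTerm_swap`).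

Terminating case, `y_r = x_r q ^ (M_r + 1)`, by strong induction on `L = |M|`: after multiplication
by `(α c)_L` both sides are polynomials in `c` of degree at most `L`, so `L + 1` nodes suffice. At
the `L` nodes `c = x_s q ^ (j + 1)` with `j < M_s`, the exchange of `c` and `y_s` gives an instance
with `M_s` lowered to `j`. At `c = q ^ (1 - L) / α` only the term `k = M` survives, and it is a
product that can be evaluated (`rogers_top_value`). This needs generic `α`; continuity removes the
restriction (`terminating_sum_cleared`).

General case: the `y_s` are freed one at a time. Multiplied by `(α y_s)_∞`, both sides are analytic
in `y_s` on a disc around `0` containing the given value. They agree at the points `x_s q ^ (m +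
1)`, which accumulate at `0`, so the identity theorem applies (`hasSum_symTerm_of_eventually`). -/

lemma qShifted_zero (q z : ℂ) : qShifted q z 0 = 1 := by simp [qShifted]

lemma qShifted_succ (q z : ℂ) (m : ℕ) :
    qShifted q z (m + 1) = qShifted q z m * (1 - z * q ^ m) := prod_range_succ _ _

lemma qShifted_add (q z : ℂ) (m n : ℕ) :
    qShifted q z (m + n) = qShifted q z m * qShifted q (z * q ^ m) n := by
  simp only [qShifted, prod_range_add]
  congr 1
  exact prod_congr rfl fun j _ => by ring

lemma qShifted_succ' (q z : ℂ) (m : ℕ) :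
    qShifted q z (m + 1) = (1 - z) * qShifted q (q * z) m := by
  rw [add_comm, qShifted_add, qShifted_succ, qShifted_zero]
  simp [mul_comm]

lemma continuous_qShifted (q : ℂ) (m : ℕ) : Continuous fun z => qShifted q z m := by
  unfold qShifted; fun_prop

variable {q : ℂ}

lemma summable_norm_mul_pow (hq : ‖q‖ < 1) (z : ℂ) : Summable fun j : ℕ => ‖-(z * q ^ j)‖ := by
  simpa using (summable_geometric_of_lt_one (norm_nonneg q) hq).mul_left ‖z‖

lemma multipliable_qShifted (hq : ‖q‖ < 1) (z : ℂ) : Multipliable fun j : ℕ => 1 - z * q ^ j := by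
  simpa [sub_eq_add_neg] using multipliable_one_add_of_summable (summable_norm_mul_pow hq z)

lemma qShiftedInf_eq_mul (hq : ‖q‖ < 1) (z : ℂ) (m : ℕ) :
    qShiftedInf q z = qShifted q z m * qShiftedInf q (z * q ^ m) := by
  have h : (fun j : ℕ => 1 - z * q ^ (j + m)) = fun j => 1 - z * q ^ m * q ^ j := by
    ext j; ring
  have := Multipliable.prod_mul_tprod_nat_mul' (f := fun j : ℕ => 1 - z * q ^ j) (k := m)
    (by rw [h]; exact multipliable_qShifted hq _)
  rw [h] at this
  exact this.symm

lemma qShifted_ne_zero (hq : ‖q‖ < 1) {z : ℂ} (hz : qShiftedInf q z ≠ 0) (m : ℕ) :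
    qShifted q z m ≠ 0 := by
  rw [qShiftedInf_eq_mul hq z m] at hz
  exact left_ne_zero_of_mul hz

lemma qShiftedInf_mul_pow_ne_zero (hq : ‖q‖ < 1) {z : ℂ} (hz : qShiftedInf q z ≠ 0) (m : ℕ) :
    qShiftedInf q (z * q ^ m) ≠ 0 := by
  rw [qShiftedInf_eq_mul hq z m] at hz
  exact right_ne_zero_of_mul hz

lemma qShiftedInf_ne_zero (hq : ‖q‖ < 1) {z : ℂ} (hz : ∀ m, qShifted q z m ≠ 0) :
    qShiftedInf q z ≠ 0 := by
  have := tprod_one_add_ne_zero_of_summable (f := fun j : ℕ => -(z * q ^ j)) (fun j => by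
    have := hz (j + 1)
    rw [qShifted_succ] at this
    simpa [sub_eq_add_neg] using right_ne_zero_of_mul this) (summable_norm_mul_pow hq z)
  simpa [qShiftedInf, sub_eq_add_neg] using this

lemma qShiftedInf_ne_zero_of_norm_lt_one (hq : ‖q‖ < 1) {z : ℂ} (hz : ‖z‖ < 1) :
    qShiftedInf q z ≠ 0 := by
  refine qShiftedInf_ne_zero hq fun m => prod_ne_zero_iff.2 fun j _ h => ?_
  have h1 : ‖z * q ^ j‖ = 1 := by rw [← sub_eq_zero.1 h]; simp
  rw [norm_mul, norm_pow] at h1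
  have := pow_le_one₀ (n := j) (norm_nonneg q) hq.le
  nlinarith [norm_nonneg z]

lemma tendsto_qShifted (hq : ‖q‖ < 1) (z : ℂ) :
    Tendsto (qShifted q z) atTop (𝓝 (qShiftedInf q z)) :=
  (multipliable_qShifted hq z).hasProd.tendsto_prod_nat

/-- On each disc the partial products converge locally uniformly, by comparison with a geometric
series; the discs exhaust the plane. -/
lemma differentiable_qShiftedInf (hq : ‖q‖ < 1) : Differentiable ℂ (qShiftedInf q) := by
  have key : ∀ R : ℝ, DifferentiableOn ℂ (qShiftedInf q) (Metric.ball 0 R) := by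
    intro R
    have h := Summable.hasProdLocallyUniformlyOn_nat_one_add (K := Metric.ball (0 : ℂ) R)
      (f := fun j z => -(z * q ^ j)) Metric.isOpen_ball
      ((summable_geometric_of_lt_one (norm_nonneg q) hq).mul_left R)
      (Eventually.of_forall fun j z hz => by
        have : ‖z‖ < R := by simpa using hz
        simp only [norm_neg, norm_mul, norm_pow]
        gcongr)
      (fun j => by fun_prop)
    have h2 := h.tendstoLocallyUniformlyOn_finsetRange.differentiableOn
      (Eventually.of_forall fun N => by fun_prop) Metric.isOpen_ball
    simp only [← sub_eq_add_neg] at h2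
    exact h2
  intro z
  exact (key (‖z‖ + 1)).differentiableAt (Metric.isOpen_ball.mem_nhds (by simp))

lemma exists_norm_qShifted_le (hq : ‖q‖ < 1) (z : ℂ) : ∃ C > 0, ∀ m, ‖qShifted q z m‖ ≤ C := by
  obtain ⟨C, hC⟩ := (tendsto_qShifted hq z).norm.bddAbove_range
  exact ⟨max C 1, by positivity, fun m => (hC ⟨m, rfl⟩).trans (le_max_left _ _)⟩

lemma exists_norm_inv_qShifted_le (hq : ‖q‖ < 1) {z : ℂ} (hz : qShiftedInf q z ≠ 0) :
    ∃ C > 0, ∀ m, ‖(qShifted q z m)⁻¹‖ ≤ C := by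
  obtain ⟨C, hC⟩ := ((tendsto_qShifted hq z).inv₀ hz).norm.bddAbove_range
  exact ⟨max C 1, by positivity, fun m => (hC ⟨m, rfl⟩).trans (le_max_left _ _)⟩

end QShifted

/-- The majorant for all convergence arguments: the sum factors into `n` geometric series. -/
lemma summable_pow_sum {θ : ℝ} (h0 : 0 ≤ θ) (h1 : θ < 1) (n : ℕ) :
    Summable fun k : Fin n → ℕ => θ ^ (∑ i, k i) := by
  induction n with
  | zero => exact (hasSum_fintype _).summable
  | succ n ih =>
    have := (summable_geometric_of_lt_one h0 h1).mul_of_nonneg ih (fun _ => by positivity)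
      (fun _ => by positivity)
    rw [← (Fin.consEquiv fun _ : Fin (n + 1) => ℕ).summable_iff]
    refine this.congr fun p => ?_
    simp [Fin.consEquiv, Fin.sum_univ_succ, pow_add]

/-! ### The summand as a symmetric function of `c` and the `y_s` -/

section SymmetricForm

variable {n : ℕ}

/-- The homogeneous form `∏_r ∏_{j < k_r} (y - x_r q ^ (j + 1))` of
`y ^ |k| ∏_r (q x_r / y; q)_{k_r}`. -/
def shiftedNumer (q : ℂ) (x : Fin n → ℂ) (k : Fin n → ℕ) (y : ℂ) : ℂ :=
  ∏ r, ∏ j ∈ range (k r), (y - x r * q ^ (j + 1))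

/-- The part of the summand `rogersTerm` that does not depend on `c` and the `a_r`. -/
noncomputable def rogersCore (q α b : ℂ) (x : Fin n → ℂ) (k : Fin n → ℕ) : ℂ :=
  vandermondeFactor q x k * q ^ (∑ r : Fin n, (r : ℕ) * k r)
    * (∏ r, ∏ s, (qShifted q (q * x r / x s) (k r))⁻¹)
    * (∏ r, (1 - α * x r * q ^ (k r + ∑ i, k i)) / (1 - α * x r))
    * (∏ r, qShifted q (α * x r) (∑ i, k i))
    * qShifted q (q / b) (∑ i, k i)
    * (∏ r, (qShifted q (α * b * x r) (k r))⁻¹)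
    * (α * b / ((∏ r, x r) * q ^ (1 + n))) ^ (∑ i, k i)

/-- The summand `rogersTerm` in terms of `y_r = a_r x_r`. -/
noncomputable def symTerm (q α b c : ℂ) (x y : Fin n → ℂ) (k : Fin n → ℕ) : ℂ :=
  rogersCore q α b x k
    * (∏ t, shiftedNumer q x k (y t) / qShifted q (α * y t) (∑ i, k i))
    * (shiftedNumer q x k c / qShifted q (α * c) (∑ i, k i))

lemma shiftedNumer_eq (q : ℂ) (x : Fin n → ℂ) (k : Fin n → ℕ) {y : ℂ} (hy : y ≠ 0) :
    shiftedNumer q x k y = y ^ (∑ i, k i) * ∏ r, qShifted q (q * x r / y) (k r) := by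
  simp only [shiftedNumer, qShifted]
  rw [← prod_pow_eq_pow_sum, ← prod_mul_distrib]
  refine prod_congr rfl fun r _ => ?_
  have h : y ^ k r = ∏ _j ∈ range (k r), y := by simp
  rw [h, ← prod_mul_distrib]
  refine prod_congr rfl fun j _ => ?_
  field_simp
  ring

lemma rogersTerm_eq_symTerm (q α b : ℂ) {c : ℂ} {x a : Fin n → ℂ} (hc : c ≠ 0)
    (hx : ∀ r, x r ≠ 0) (ha : ∀ r, a r ≠ 0) (k : Fin n → ℕ) :
    rogersTerm q α b c x a k = symTerm q α b c x (fun r => x r * a r) k := by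
  have hX : ∏ r, x r ≠ 0 := prod_ne_zero_iff.2 fun r _ => hx r
  have h1 : ∏ t, shiftedNumer q x k (x t * a t) =
      ((∏ t, x t) * ∏ t, a t) ^ (∑ i, k i)
        * ∏ r, ∏ s, qShifted q (q * x r / (x s * a s)) (k r) := by
    rw [Finset.prod_comm, ← prod_mul_distrib, ← prod_pow, ← prod_mul_distrib]
    exact prod_congr rfl fun t _ => shiftedNumer_eq q x k (mul_ne_zero (hx t) (ha t))
  have h2 : rogersArg q α b c a ^ (∑ i, k i) =
      (α * b / ((∏ r, x r) * q ^ (1 + n))) ^ (∑ i, k i)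
        * ((∏ t, x t) * ∏ t, a t) ^ (∑ i, k i) * c ^ (∑ i, k i) := by
    rw [← mul_pow, ← mul_pow, rogersArg]
    congr 1
    field_simp
  simp only [rogersTerm, symTerm, rogersCore, prod_div_distrib, prod_inv_distrib, h1, h2,
    shiftedNumer_eq q x k hc, mul_assoc α (x _) (a _)]
  ring

lemma prod_update_eq {ι : Type*} [Fintype ι] [DecidableEq ι] (f : ℂ → ℂ) (y : ι → ℂ) (s : ι)
    (z : ℂ) : ∏ t, f (Function.update y s z t) = f z * ∏ t ∈ univ.erase s, f (y t) := by
  rw [← mul_prod_erase univ _ (mem_univ s), Function.update_self]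
  congr 1
  exact prod_congr rfl fun t ht => by rw [Function.update_of_ne (ne_of_mem_erase ht)]

/-- The variable `c` enters through the same factor as each `y_t`, so it acts as one more `y`. This
hidden symmetry drives the induction in the terminating case. -/
lemma symTerm_swap (q α b c : ℂ) (x y : Fin n → ℂ) (s : Fin n) (k : Fin n → ℕ) :
    symTerm q α b (y s) x (Function.update y s c) k = symTerm q α b c x y k := by
  rw [symTerm, symTerm, prod_update_eq (fun z => shiftedNumer q x k z / qShifted q (α * z) _),
    ← mul_prod_erase univ _ (mem_univ s)]
  ring

lemma shiftedNumer_eq_zero (q : ℂ) (x : Fin n → ℂ) {k : Fin n → ℕ} {s : Fin n} {j : ℕ}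
    (h : j < k s) : shiftedNumer q x k (x s * q ^ (j + 1)) = 0 :=
  prod_eq_zero (mem_univ s) (prod_eq_zero (mem_range.2 h) (sub_self _))

lemma symTerm_eq_zero (q α b c : ℂ) (x y : Fin n → ℂ) {k : Fin n → ℕ} {s : Fin n} {j : ℕ}
    (h : j < k s) (hy : y s = x s * q ^ (j + 1)) : symTerm q α b c x y k = 0 := by
  have : ∏ t, shiftedNumer q x k (y t) / qShifted q (α * y t) (∑ i, k i) = 0 :=
    prod_eq_zero (mem_univ s) (by rw [hy, shiftedNumer_eq_zero q x h, zero_div])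
  rw [symTerm, this]
  ring

end SymmetricForm

/-! ### Product identities for the term `k = M` -/

section TopTerm

variable {q : ℂ}

lemma qShifted_ne_zero_of_ne_zpow {z : ℂ} (hz : ∀ j : ℤ, z ≠ q ^ j) (m : ℕ) :
    qShifted q z m ≠ 0 := by
  refine prod_ne_zero_iff.2 fun j _ h => hz (-j) ?_
  rw [zpow_neg, zpow_natCast]
  exact eq_inv_of_mul_eq_one_left (sub_eq_zero.1 h).symm

lemma mul_pow_ne_zpow (hq : q ≠ 0) {z : ℂ} (hz : ∀ j : ℤ, z ≠ q ^ j) (m : ℕ) (j : ℤ) :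
    z * q ^ m ≠ q ^ j := by
  intro h
  refine hz (j - m) ?_
  rw [zpow_sub₀ hq, zpow_natCast, ← h]
  field_simp

/-- Reversal of the order of the factors: factor `j` of the first product times factor `m - 1 - j`
of the second is `1 - z q ^ (m - 1 - j)`. -/
lemma qShifted_reflect (hq : q ≠ 0) {z : ℂ} (hz : z ≠ 0) (m : ℕ) :
    qShifted q (q / (z * q ^ m)) m * ∏ j ∈ range m, (-(z * q ^ j)) = qShifted q z m := by
  induction m with
  | zero => simp [qShifted]
  | succ m ih =>
    have h : q * (q / (z * q ^ (m + 1))) = q / (z * q ^ m) := by field_simp; ring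
    rw [qShifted_succ', qShifted_succ, prod_range_succ, h, ← ih]
    field_simp
    ring

/-- `∏_{j < m} (-q ^ (j + 1)) = (-1) ^ m q ^ (m (m + 1) / 2)`. -/
def signedTriangle (q : ℂ) (m : ℕ) : ℂ := ∏ j ∈ range m, (-(q * q ^ j))

/-- Triangular numbers satisfy `T(m + p) = T(m) + T(p) + m p`; the cross terms are later absorbed by
the pairs `r < s`. -/
lemma signedTriangle_add (q : ℂ) (m p : ℕ) :
    signedTriangle q (m + p) = signedTriangle q m * signedTriangle q p * q ^ (m * p) := by
  simp only [signedTriangle, prod_range_add]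
  have h : q ^ (m * p) = ∏ _j ∈ range p, q ^ m := by simp [pow_mul]
  rw [h, mul_assoc, ← prod_mul_distrib]
  congr 1
  exact prod_congr rfl fun j _ => by ring

lemma signedTriangle_sum (q : ℂ) (n : ℕ) (M : Fin n → ℕ) :
    signedTriangle q (∑ r, M r) =
      (∏ r, signedTriangle q (M r)) * ∏ r, ∏ s ∈ Ioi r, q ^ (M r * M s) := by
  induction n with
  | zero => simp [signedTriangle]
  | succ n ih =>
    rw [Fin.sum_univ_succ, signedTriangle_add, ih, Fin.prod_univ_succ, Fin.prod_univ_succ,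
      Fin.prod_Ioi_zero, mul_sum, prod_pow_eq_pow_sum]
    simp only [Fin.prod_Ioi_succ]
    ring

/-- With indices from `0`, the index `s` is the larger member of exactly `s` pairs, so the power of
`q` can be distributed over the pairs `r < s`. -/
lemma pow_sum_index_mul (q : ℂ) (n : ℕ) (k : Fin n → ℕ) :
    q ^ (∑ r : Fin n, (r : ℕ) * k r) = ∏ r, ∏ s ∈ Ioi r, q ^ k s := by
  induction n with
  | zero => simp
  | succ n ih =>
    rw [Fin.sum_univ_succ, Fin.prod_univ_succ, Fin.prod_Ioi_zero]
    simp only [Fin.prod_Ioi_succ]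
    rw [← ih, prod_pow_eq_pow_sum, ← pow_add]
    congr 1
    simp only [Fin.val_zero, zero_mul, zero_add, Fin.val_succ, add_mul, one_mul, sum_add_distrib]
    ring

lemma prod_prod_eq_diag_mul {n : ℕ} (f : Fin n → Fin n → ℂ) :
    ∏ r, ∏ s, f r s = (∏ r, f r r) * ∏ r, ∏ s ∈ Ioi r, f r s * f s r := by
  have h := prod_prod_Ioi_mul_eq_prod_prod_off_diag (fun r s => f s r)
  rw [h, ← prod_mul_distrib]
  refine prod_congr rfl fun r _ => ?_
  rw [← Fintype.prod_eq_mul_prod_compl r (f r)]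

/-- The total contribution of a pair `r < s` to the top term is trivial, with `u = x_r / x_s`, `m =
M_r`, `p = M_s`. -/
lemma vandermonde_pair (hq : q ≠ 0) {u : ℂ} (hu0 : u ≠ 0) (hu : ∀ j : ℤ, u ≠ q ^ j) (m p : ℕ) :
    (1 - q ^ ((m : ℤ) - p) * u) / (1 - u) * q ^ p
      * ((qShifted q (q * u / q ^ (p + 1)) m * (qShifted q (q * u) m)⁻¹)
        * (qShifted q (q / (u * q ^ (m + 1))) p * (qShifted q (q / u) p)⁻¹)) * q ^ (m * p) = 1 := by
  obtain ⟨v, rfl⟩ : ∃ v, u = v * q ^ p := ⟨u / q ^ p, by field_simp⟩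
  have hv0 : v ≠ 0 := left_ne_zero_of_mul hu0
  have hv : ∀ j : ℤ, v ≠ q ^ j := fun j h => hu (j + p) (by
    rw [h, zpow_add₀ hq, zpow_natCast])
  -- Both sides are `(v)_{m + p + 1}`, split after `m + 1` and after `p` factors.
  have h1 : qShifted q v m * (1 - v * q ^ m) * qShifted q (v * q ^ (m + 1)) p
      = qShifted q v p * ((1 - v * q ^ p) * qShifted q (q * (v * q ^ p)) m) := by
    rw [← qShifted_succ, ← qShifted_succ', ← qShifted_add, ← qShifted_add, add_comm]
  have h2 := qShifted_reflect hq hv0 p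
  have h3 := qShifted_reflect hq (mul_ne_zero hv0 (pow_ne_zero (m + 1) hq)) p
  have h4 : ∏ j ∈ range p, (-(v * q ^ (m + 1) * q ^ j))
      = (∏ j ∈ range p, (-(v * q ^ j))) * (q ^ p * q ^ (m * p)) := by
    have h : q ^ p * q ^ (m * p) = ∏ _j ∈ range p, q ^ (m + 1) := by
      simp only [prod_const, card_range]; ring
    rw [h, ← prod_mul_distrib]
    exact prod_congr rfl fun j _ => by ring
  rw [h4] at h3
  have e1 : q * (v * q ^ p) / q ^ (p + 1) = v := by field_simp; ring
  have e2 : q ^ ((m : ℤ) - p) * (v * q ^ p) = v * q ^ m := by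
    rw [zpow_sub₀ hq, zpow_natCast, zpow_natCast]; field_simp
  have e3 : v * q ^ p * q ^ (m + 1) = v * q ^ (m + 1) * q ^ p := by ring
  rw [e1, e2, e3]
  have n1 : 1 - v * q ^ p ≠ 0 := fun h => hu 0 (by simpa using (sub_eq_zero.1 h).symm)
  have n2 : qShifted q (q * (v * q ^ p)) m ≠ 0 := by
    rw [mul_comm q]
    exact qShifted_ne_zero_of_ne_zpow (by simpa using mul_pow_ne_zpow hq hu 1) m
  have n3 : qShifted q v p ≠ 0 := qShifted_ne_zero_of_ne_zpow hv p
  have n4 : qShifted q (v * q ^ (m + 1)) p ≠ 0 :=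
    qShifted_ne_zero_of_ne_zpow (mul_pow_ne_zpow hq hv _) p
  have n5 : qShifted q (q / (v * q ^ p)) p ≠ 0 := by
    rw [← h2] at n3; exact left_ne_zero_of_mul n3
  have n6 : ∏ j ∈ range p, (-(v * q ^ j)) ≠ 0 := by
    rw [← h2] at n3; exact right_ne_zero_of_mul n3
  generalize qShifted q (q * (v * q ^ p)) m = B at *
  generalize qShifted q v p = V at *
  generalize qShifted q v m = A at *
  generalize qShifted q (v * q ^ (m + 1)) p = W at *
  generalize qShifted q (q / (v * q ^ p)) p = F at *
  generalize qShifted q (q / (v * q ^ (m + 1) * q ^ p)) p = E at *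
  generalize ∏ j ∈ range p, (-(v * q ^ j)) = P at *
  field_simp
  refine mul_right_cancel₀ (mul_ne_zero n4 n6) ?_
  linear_combination (q ^ p * q ^ (m * p) * E * P) * h1 + ((1 - v * q ^ p) * B * V) * h3
    - ((1 - v * q ^ p) * B * W) * h2

variable {n : ℕ} {x : Fin n → ℂ}

/-- The diagonal factors `r = s` cancel the individual signed triangles by reflection, and each pair
cancels its cross term `q ^ (M_r M_s)`. -/
lemma vandermonde_top (hq : q ≠ 0) (hq1 : ‖q‖ < 1) (hx : ∀ r, x r ≠ 0)
    (hgen : ∀ r s, r ≠ s → ∀ m : ℤ, x r / x s ≠ q ^ m) (M : Fin n → ℕ) :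
    vandermondeFactor q x M * q ^ (∑ r : Fin n, (r : ℕ) * M r)
      * (∏ r, ∏ s, qShifted q (q * x r / (x s * q ^ (M s + 1))) (M r)
          * (qShifted q (q * x r / x s) (M r))⁻¹) * signedTriangle q (∑ r, M r) = 1 := by
  rw [prod_prod_eq_diag_mul, pow_sum_index_mul, signedTriangle_sum, vandermondeFactor]
  have hd : ∀ r, qShifted q (q * x r / (x r * q ^ (M r + 1))) (M r)
      * (qShifted q (q * x r / x r) (M r))⁻¹ * signedTriangle q (M r) = 1 := by
    intro r
    have h := qShifted_reflect hq hq (M r)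
    have e1 : q * x r / (x r * q ^ (M r + 1)) = q / (q * q ^ M r) := by
      have := hx r; field_simp; ring
    have e2 : q * x r / x r = q := by have := hx r; field_simp
    have h0 : qShifted q q (M r) ≠ 0 := qShifted_ne_zero hq1
      (qShiftedInf_ne_zero_of_norm_lt_one hq1 hq1) _
    rw [e1, e2, mul_right_comm, signedTriangle, h, mul_inv_cancel₀ h0]
  have hp : ∀ r, ∀ s ∈ Ioi r, (1 - q ^ ((M r : ℤ) - (M s : ℤ)) * (x r / x s)) / (1 - x r / x s)
      * q ^ M s * ((qShifted q (q * x r / (x s * q ^ (M s + 1))) (M r)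
          * (qShifted q (q * x r / x s) (M r))⁻¹)
        * (qShifted q (q * x s / (x r * q ^ (M r + 1))) (M s)
          * (qShifted q (q * x s / x r) (M s))⁻¹)) * q ^ (M r * M s) = 1 := by
    intro r s hrs
    have h := vandermonde_pair hq (div_ne_zero (hx r) (hx s))
      (hgen r s (ne_of_lt (mem_Ioi.1 hrs))) (M r) (M s)
    have hr := hx r
    have hs := hx s
    have e1 : q * (x r / x s) / q ^ (M s + 1) = q * x r / (x s * q ^ (M s + 1)) := by field_simp
    have e2 : q / (x r / x s * q ^ (M r + 1)) = q * x s / (x r * q ^ (M r + 1)) := by field_simp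
    have e3 : q / (x r / x s) = q * x s / x r := by field_simp
    have e4 : q * (x r / x s) = q * x r / x s := by field_simp
    rwa [e1, e2, e3, e4] at h
  have H1 := prod_congr rfl fun r (_ : r ∈ univ) => hd r
  have H2 := prod_congr rfl fun r (_ : r ∈ univ) => prod_congr rfl (hp r)
  simp only [prod_mul_distrib, prod_const_one] at H1 H2 ⊢
  refine Eq.trans ?_ ((congrArg₂ (· * ·) H1 H2).trans (mul_one 1))
  ring

end TopTerm

/-! ### The terminating sum for generic `α`, by interpolation in `c` -/

section Terminating

variable {q α b : ℂ} {n : ℕ} {x : Fin n → ℂ}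

lemma rogers_top_value (hq : q ≠ 0) (hq1 : ‖q‖ < 1) (hb : b ≠ 0) (hx : ∀ r, x r ≠ 0)
    (hgen : ∀ r s, r ≠ s → ∀ m : ℤ, x r / x s ≠ q ^ m)
    (hαx : ∀ r, ∀ m : ℤ, α * x r ≠ q ^ m) (M : Fin n → ℕ) {c : ℂ}
    (hc : α * c * q ^ (∑ i, M i) = q) :
    rogersCore q α b x M
      * (∏ t, shiftedNumer q x M (x t * q ^ (M t + 1))
          / qShifted q (α * (x t * q ^ (M t + 1))) (∑ i, M i)) * shiftedNumer q x M c
      = qShifted q (α * b * c / q) (∑ i, M i)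
        * ∏ r, qShifted q (α * q * x r) (M r) / qShifted q (α * b * x r) (M r) := by
  set L := ∑ i, M i with hL
  have hc0 : c ≠ 0 := by rintro rfl; simp [hq.symm] at hc
  have hα0 : α ≠ 0 := by rintro rfl; simp [hq.symm] at hc
  have hX : ∏ r, x r ≠ 0 := prod_ne_zero_iff.2 fun r _ => hx r
  have hw : ∏ t, shiftedNumer q x M (x t * q ^ (M t + 1))
      = ((∏ t, x t) * q ^ (L + n)) ^ L
        * ∏ r, ∏ s, qShifted q (q * x r / (x s * q ^ (M s + 1))) (M r) := by
    have : (∏ t, x t) * q ^ (L + n) = ∏ t, x t * q ^ (M t + 1) := by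
      rw [prod_mul_distrib, prod_pow_eq_pow_sum, sum_add_distrib]; simp [hL]
    rw [this, Finset.prod_comm, ← prod_pow, ← prod_mul_distrib]
    exact prod_congr rfl fun t _ =>
      shiftedNumer_eq q x M (mul_ne_zero (hx t) (pow_ne_zero _ hq))
  -- The condition on `c` reads `α c q ^ L = q`, so the product of the three bases is exactly `b`.
  have hpow : (α * b / ((∏ r, x r) * q ^ (1 + n))) ^ L * ((∏ t, x t) * q ^ (L + n)) ^ L * c ^ L
      = b ^ L := by
    rw [← mul_pow, ← mul_pow]
    congr 1
    have : q ^ (1 + n) = q * q ^ n := by ring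
    rw [this, pow_add]
    field_simp
    linear_combination hc
  -- Since `q x_r / c = α x_r q ^ L`, this is `(α x_r)_{M_r + L + 1}` split in two ways.
  have hfac : (∏ r, (1 - α * x r * q ^ (M r + L)) / (1 - α * x r)) * (∏ r, qShifted q (α * x r) L)
      * (∏ r, (qShifted q (α * (x r * q ^ (M r + 1))) L)⁻¹)
      * (∏ r, qShifted q (q * x r / c) (M r)) = ∏ r, qShifted q (α * q * x r) (M r) := by
    simp only [← prod_mul_distrib]
    refine prod_congr rfl fun r _ => ?_
    have e1 : q * x r / c = α * x r * q ^ L := by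
      field_simp; linear_combination -x r * hc
    have e2 : α * (x r * q ^ (M r + 1)) = q * (α * x r) * q ^ M r := by ring
    have e3 : α * q * x r = q * (α * x r) := by ring
    have h := qShifted_add q (q * (α * x r)) (M r) L
    have h' := qShifted_succ' q (α * x r) (M r + L)
    rw [h, add_comm (M r), qShifted_succ, qShifted_add] at h'
    rw [e1, e2, e3]
    have n1 : 1 - α * x r ≠ 0 := fun h => hαx r 0 (by simpa using (sub_eq_zero.1 h).symm)
    have n2 : qShifted q (q * (α * x r) * q ^ M r) L ≠ 0 := by
      have := mul_pow_ne_zpow hq (hαx r) (M r + 1)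
      rw [← e2, ← mul_assoc]
      exact qShifted_ne_zero_of_ne_zpow this L
    rw [add_comm (M r)]
    generalize qShifted q (q * (α * x r) * q ^ M r) L = A at *
    generalize qShifted q (α * x r * q ^ L) (M r) = B at *
    generalize qShifted q (q * (α * x r)) (M r) = D at *
    field_simp
    linear_combination h'
  -- Reversing `(q / b)_L` produces the parameter `q / ((q / b) q ^ L) = α b c / q`.
  have hbL : qShifted q (q / b) L * b ^ L
      = qShifted q (α * b * c / q) L * signedTriangle q L := by
    have h := qShifted_reflect hq (div_ne_zero hq hb) L
    have e : q / (q / b * q ^ L) = α * b * c / q := by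
      field_simp; linear_combination -hc
    have e2 : signedTriangle q L = (∏ j ∈ range L, (-(q / b * q ^ j))) * b ^ L := by
      have : b ^ L = ∏ _j ∈ range L, b := by simp
      rw [this, ← prod_mul_distrib]
      exact prod_congr rfl fun j _ => by field_simp
    rw [e] at h
    rw [e2, ← h]
    ring
  have hv := vandermonde_top hq hq1 hx hgen M
  simp only [rogersCore, hw, shiftedNumer_eq q x M hc0, ← hL, prod_mul_distrib, prod_inv_distrib,
    div_eq_mul_inv] at hfac hv hpow hbL ⊢
  rw [← hfac]
  generalize ∏ r, ∏ s, qShifted q (q * x r * (x s * q ^ (M s + 1))⁻¹) (M r) = A1 at *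
  generalize ∏ r, ∏ s, qShifted q (q * x r * (x s)⁻¹) (M r) = A2 at *
  generalize ∏ r, (1 - α * x r * q ^ (M r + L)) = F1 at *
  generalize ∏ r, (1 - α * x r) = F2 at *
  generalize ∏ r, qShifted q (α * x r) L = F3 at *
  generalize ∏ r, qShifted q (α * (x r * q ^ (M r + 1))) L = F4 at *
  generalize ∏ r, qShifted q (q * x r * c⁻¹) (M r) = F5 at *
  generalize ∏ r, qShifted q (α * b * x r) (M r) = G at *
  generalize qShifted q (q * b⁻¹) L = S at *
  generalize qShifted q (α * b * c * q⁻¹) L = Z at *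
  generalize (α * b * ((∏ r, x r) * q ^ (1 + n))⁻¹) ^ L = P1 at *
  generalize ((∏ r, x r) * q ^ (L + n)) ^ L = P2 at *
  generalize vandermondeFactor q x M * q ^ ∑ r : Fin n, (r : ℕ) * M r = V at *
  linear_combination (F1 * F2⁻¹ * F3 * F4⁻¹ * F5 * G⁻¹ * V * (A1 * A2⁻¹)) * (S * hpow + hbL)
    + (F1 * F2⁻¹ * F3 * F4⁻¹ * F5 * G⁻¹ * Z) * hv

/-- The multi-indices `k` with `k_r ≤ M_r` for all `r`. -/
def multiBox (M : Fin n → ℕ) : Finset (Fin n → ℕ) := Fintype.piFinset fun r => range (M r + 1)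

lemma mem_multiBox {M k : Fin n → ℕ} : k ∈ multiBox M ↔ ∀ r, k r ≤ M r := by
  simp [multiBox]

lemma natDegree_prod_le_card {ι : Type*} (s : Finset ι) (f : ι → Polynomial ℂ)
    (h : ∀ i ∈ s, (f i).natDegree ≤ 1) : (∏ i ∈ s, f i).natDegree ≤ #s := by
  refine (Polynomial.natDegree_prod_le s f).trans ?_
  simpa using sum_le_card_nsmul s _ 1 h

lemma exists_poly_shiftedNumer_mul (q β : ℂ) (x : Fin n → ℂ) (k : Fin n → ℕ) (m : ℕ) :
    ∃ P : Polynomial ℂ, P.natDegree ≤ (∑ i, k i) + m ∧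
      ∀ c, P.eval c = shiftedNumer q x k c * qShifted q (β * c) m := by
  refine ⟨(∏ r, ∏ j ∈ range (k r), (Polynomial.X - Polynomial.C (x r * q ^ (j + 1))))
    * ∏ j ∈ range m, (1 - Polynomial.C (β * q ^ j) * Polynomial.X), ?_, fun c => ?_⟩
  · refine Polynomial.natDegree_mul_le_of_le ?_ ?_
    · refine (Polynomial.natDegree_prod_le _ _).trans (sum_le_sum fun r _ => ?_)
      simpa using natDegree_prod_le_card (range (k r))
        (fun j => Polynomial.X - Polynomial.C (x r * q ^ (j + 1))) fun j _ =>
          (Polynomial.natDegree_X_sub_C _).le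
    · simpa using natDegree_prod_le_card (range m)
        (fun j => 1 - Polynomial.C (β * q ^ j) * Polynomial.X) fun j _ => by compute_degree
  · simp only [Polynomial.eval_mul, Polynomial.eval_prod, Polynomial.eval_sub, Polynomial.eval_X,
      Polynomial.eval_C, Polynomial.eval_one, shiftedNumer, qShifted]
    congr 1
    exact prod_congr rfl fun j _ => by ring

/-- Genericity of the ratios `x_r / x_s`, and `‖q‖ < 1` for equal indices, make the `|M|` nodes
distinct; with `c₀` there is one node more than the degree bound. -/
lemma eq_of_eval_eq_on_nodes (hq : q ≠ 0) (hq1 : ‖q‖ < 1) (hx : ∀ r, x r ≠ 0)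
    (hgen : ∀ r s, r ≠ s → ∀ m : ℤ, x r / x s ≠ q ^ m) (M : Fin n → ℕ)
    (P R : Polynomial ℂ) (hP : P.natDegree ≤ ∑ r, M r) (hR : R.natDegree ≤ ∑ r, M r)
    {c₀ : ℂ} (hc₀ : ∀ r, ∀ j : ℕ, c₀ ≠ x r * q ^ (j + 1)) (h₀ : P.eval c₀ = R.eval c₀)
    (h : ∀ s, ∀ j < M s, P.eval (x s * q ^ (j + 1)) = R.eval (x s * q ^ (j + 1))) : P = R := by
  classical
  set T : Finset ((_ : Fin n) × ℕ) := univ.sigma fun s => range (M s)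
  set f : ((_ : Fin n) × ℕ) → ℂ := fun p => x p.1 * q ^ (p.2 + 1)
  have hinj : Function.Injective f := by
    rintro ⟨r, i⟩ ⟨s, j⟩ hij
    simp only [f] at hij
    have hz : x r / x s = q ^ ((j : ℤ) - i) := by
      have := hx s
      rw [zpow_sub₀ hq, zpow_natCast, zpow_natCast]
      field_simp
      have h2 := mul_right_cancel₀ hq (show x r * q ^ i * q = q ^ j * x s * q by
        rw [pow_succ, pow_succ] at hij; linear_combination hij)
      exact h2.trans (by ring)
    have hrs : r = s := by
      by_contra hne
      exact hgen r s hne _ hz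
    subst hrs
    have h3 := mul_left_cancel₀ (hx r) hij
    have h4 : ‖q‖ ^ (i + 1) = ‖q‖ ^ (j + 1) := by rw [← norm_pow, h3, norm_pow]
    have := pow_right_injective₀ (norm_pos_iff.2 hq) hq1.ne h4
    simp only [Nat.add_right_cancel_iff] at this
    rw [this]
  have hnot : c₀ ∉ T.image f := by
    rw [mem_image]
    rintro ⟨⟨r, j⟩, -, hj⟩
    exact hc₀ r j hj.symm
  rw [← sub_eq_zero]
  refine Polynomial.eq_zero_of_natDegree_lt_card_of_eval_eq_zero' _ (insert c₀ (T.image f)) ?_ ?_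
  · intro z hz
    rw [Polynomial.eval_sub, sub_eq_zero]
    rcases mem_insert.1 hz with rfl | hz
    · exact h₀
    · obtain ⟨⟨s, j⟩, hm, rfl⟩ := mem_image.1 hz
      exact h s j (by simpa [T] using hm)
  · rw [card_insert_of_notMem hnot, card_image_of_injective _ hinj, card_sigma]
    simp only [card_range]
    exact Nat.lt_succ_of_le ((Polynomial.natDegree_sub_le _ _).trans (max_le hP hR))

/-- Replacing `M_s` by `j` and `c = x_s q ^ (j + 1)` by `x_s q ^ (M_s + 1)` does not change the
value of the terminating sum. -/
lemma terminating_value_swap (hq : q ≠ 0) (β : ℂ) (M : Fin n → ℕ) (s : Fin n) (j : ℕ)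
    (h1 : ∀ r m, qShifted q (α * x r * q) m ≠ 0) (h2 : ∀ r m, qShifted q (β * x r) m ≠ 0) :
    qShifted q (β * (x s * q ^ (M s + 1)) / q) (∑ r, Function.update M s j r)
        / qShifted q (α * (x s * q ^ (M s + 1))) (∑ r, Function.update M s j r)
        * ∏ r, qShifted q (α * q * x r) (Function.update M s j r)
            / qShifted q (β * x r) (Function.update M s j r)
      = qShifted q (β * (x s * q ^ (j + 1)) / q) (∑ r, M r)
        / qShifted q (α * (x s * q ^ (j + 1))) (∑ r, M r)
        * ∏ r, qShifted q (α * q * x r) (M r) / qShifted q (β * x r) (M r) := by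
  have hupd : ∀ r ∈ univ.erase s, Function.update M s j r = M r := fun r hr =>
    Function.update_of_ne (ne_of_mem_erase hr) _ _
  rw [← add_sum_erase univ _ (mem_univ s), ← add_sum_erase univ M (mem_univ s), sum_congr rfl hupd,
    ← mul_prod_erase univ _ (mem_univ s),
    ← mul_prod_erase univ (fun r => qShifted q (α * q * x r) (M r) / qShifted q (β * x r) (M r))
      (mem_univ s), prod_congr rfl fun r hr => by rw [hupd r hr], Function.update_self]
  generalize ∑ r ∈ univ.erase s, M r = R
  have key : ∀ z, qShifted q z (M s) * qShifted q (z * q ^ M s) (j + R)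
      = qShifted q z j * qShifted q (z * q ^ j) (M s + R) := fun z => by
    rw [← qShifted_add, ← qShifted_add]; congr 1; ring
  have e1 : ∀ i, β * (x s * q ^ (i + 1)) / q = β * x s * q ^ i := fun i => by
    field_simp; ring
  have e2 : ∀ i, α * (x s * q ^ (i + 1)) = α * x s * q * q ^ i := fun i => by ring
  have e3 : α * q * x s = α * x s * q := by ring
  have n : ∀ i m, qShifted q (α * x s * q * q ^ i) m ≠ 0 := fun i m h => by
    have := h1 s (i + m)
    rw [qShifted_add, h, mul_zero] at this
    exact this rfl
  have k1 := key (β * x s)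
  have k2 := key (α * x s * q)
  have n1 := n (M s) (j + R)
  have n2 := n j (M s + R)
  have n3 := h2 s j
  have n4 := h2 s (M s)
  rw [e1, e1, e2, e2, e3, ← mul_assoc, ← mul_assoc]
  congr 1
  rw [div_mul_div_comm, div_mul_div_comm, div_eq_div_iff (mul_ne_zero n1 n3) (mul_ne_zero n2 n4)]
  linear_combination (qShifted q (α * x s * q) j * qShifted q (α * x s * q * q ^ j) (M s + R)) * k1
    - (qShifted q (β * x s) j * qShifted q (β * x s * q ^ j) (M s + R)) * k2

/-- The quotient `(α c)_L / (α c)_{|k|}` is a shifted factorial of length `L - |k|`, so clearing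
with `(α c)_L` leaves a polynomial in `c` of degree at most `L`. -/
lemma symTerm_mul_qShifted (q α b c : ℂ) (x y : Fin n → ℂ) (k : Fin n → ℕ) {L : ℕ}
    (hL : ∑ i, k i ≤ L) (hc : ∀ m, qShifted q (α * c) m ≠ 0) :
    rogersCore q α b x k
      * (∏ t, shiftedNumer q x k (y t) / qShifted q (α * y t) (∑ i, k i))
      * (shiftedNumer q x k c * qShifted q (α * q ^ (∑ i, k i) * c) (L - ∑ i, k i))
      = symTerm q α b c x y k * qShifted q (α * c) L := by
  obtain ⟨m, rfl⟩ := Nat.exists_eq_add_of_le hL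
  have h := hc (∑ i, k i)
  rw [symTerm, qShifted_add, Nat.add_sub_cancel_left, mul_right_comm α]
  field_simp


theorem terminating_sum_cleared_of_generic (hq : q ≠ 0) (hq1 : ‖q‖ < 1) (hb : b ≠ 0) (hx : ∀ r, x r ≠ 0)
    (hgen : ∀ r s, r ≠ s → ∀ m : ℤ, x r / x s ≠ q ^ m) (hα : α ≠ 0)
    (hαx : ∀ r, ∀ m : ℤ, α * x r ≠ q ^ m) (hαbx : ∀ r m, qShifted q (α * b * x r) m ≠ 0)
    (M : Fin n → ℕ) (c : ℂ) :
    ∑ k ∈ multiBox M, rogersCore q α b x k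
      * (∏ t, shiftedNumer q x k (x t * q ^ (M t + 1))
          / qShifted q (α * (x t * q ^ (M t + 1))) (∑ i, k i))
      * (shiftedNumer q x k c
          * qShifted q (α * q ^ (∑ i, k i) * c) ((∑ i, M i) - ∑ i, k i))
      = qShifted q (α * b / q * c) (∑ i, M i)
        * ∏ r, qShifted q (α * q * x r) (M r) / qShifted q (α * b * x r) (M r) := by
  -- `c` is generalized because the smaller instance is applied with `y s` in the role of `c`.
  induction hL : ∑ i, M i using Nat.strong_induction_on generalizing M c with
  | _ L ih =>
  subst hL
  set G : ℂ := ∏ r, qShifted q (α * q * x r) (M r) / qShifted q (α * b * x r) (M r) with hG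
  have hzq : ∀ r i m, qShifted q (α * (x r * q ^ i)) m ≠ 0 := fun r i m => by
    rw [← mul_assoc]
    exact qShifted_ne_zero_of_ne_zpow (mul_pow_ne_zpow hq (hαx r) i) m
  choose P hPdeg hP using fun k : Fin n → ℕ =>
    exists_poly_shiftedNumer_mul q (α * q ^ (∑ i, k i)) x k ((∑ i, M i) - ∑ i, k i)
  -- The index `0` makes the factor `shiftedNumer` equal to `1`.
  obtain ⟨Q, hQdeg, hQ⟩ := exists_poly_shiftedNumer_mul q (α * b / q) x 0 (∑ i, M i)
  have hle : ∀ k ∈ multiBox M, ∑ i, k i ≤ ∑ i, M i := fun k hk =>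
    sum_le_sum fun i _ => mem_multiBox.1 hk i
  set K : (Fin n → ℕ) → ℂ := fun k => rogersCore q α b x k
      * (∏ t, shiftedNumer q x k (x t * q ^ (M t + 1))
          / qShifted q (α * (x t * q ^ (M t + 1))) (∑ i, k i)) with hK
  have hPe : ∀ z, (∑ k ∈ multiBox M, Polynomial.C (K k) * P k).eval z
      = ∑ k ∈ multiBox M, K k * (shiftedNumer q x k z
        * qShifted q (α * q ^ (∑ i, k i) * z) ((∑ i, M i) - ∑ i, k i)) := fun z => by
    simp only [Polynomial.eval_finsetSum, Polynomial.eval_mul, Polynomial.eval_C, hP]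
  have hQe : ∀ z, (Polynomial.C G * Q).eval z = qShifted q (α * b / q * z) (∑ i, M i) * G :=
    fun z => by
      rw [Polynomial.eval_mul, Polynomial.eval_C, hQ]
      simp [shiftedNumer, mul_comm]
  have hPQ : ∑ k ∈ multiBox M, Polynomial.C (K k) * P k = Polynomial.C G * Q := by
    refine eq_of_eval_eq_on_nodes hq hq1 hx hgen M _ _ ?_ ?_ (c₀ := q / (α * q ^ ∑ i, M i)) ?_ ?_ ?_
    · refine Polynomial.natDegree_sum_le_of_forall_le _ _ fun k hk => ?_
      refine (Polynomial.natDegree_C_mul_le _ _).trans ((hPdeg k).trans ?_)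
      have := hle k hk
      omega
    · exact (Polynomial.natDegree_C_mul_le _ _).trans (hQdeg.trans (by simp))
    · intro r j h
      -- A coincidence of nodes would give `α x_r q ^ (j + 1 + L) = q`, against genericity of `α`.
      refine mul_pow_ne_zpow hq (hαx r) (j + 1 + ∑ i, M i) 1 ?_
      field_simp at h
      rw [zpow_one, pow_add]
      linear_combination -h
    · have hc : α * (q / (α * q ^ ∑ i, M i)) * q ^ (∑ i, M i) = q := by field_simp
      rw [hPe, hQe, sum_eq_single M]
      · have := rogers_top_value hq hq1 hb hx hgen hαx M hc
        rw [Nat.sub_self, qShifted_zero, mul_one, hK]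
        rw [this, mul_div_right_comm]
      · intro k hk hkM
        have hlt : ∑ i, k i < ∑ i, M i := by
          refine sum_lt_sum (fun i _ => mem_multiBox.1 hk i) ?_
          by_contra! hcon
          exact hkM (funext fun i => le_antisymm (mem_multiBox.1 hk i) (hcon i (mem_univ i)))
        have : qShifted q (α * q ^ (∑ i, k i) * (q / (α * q ^ ∑ i, M i)))
            ((∑ i, M i) - ∑ i, k i) = 0 := by
          obtain ⟨d, hd⟩ := Nat.exists_eq_add_of_lt hlt
          -- The last factor is the vanishing one: at this node `α c q ^ (L - 1) = 1`.
          refine prod_eq_zero (i := d) (mem_range.2 (by omega)) ?_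
          rw [hd]
          field_simp
          ring
        rw [this]
        ring
      · exact fun h => absurd (mem_multiBox.2 fun _ => le_rfl) h
    · intro s j hj
      set c := x s * q ^ (j + 1) with hc
      set M' := Function.update M s j with hM'
      set y : Fin n → ℂ := fun t => x t * q ^ (M t + 1) with hy
      have hy' : (fun t => x t * q ^ (M' t + 1)) = Function.update y s c := by
        ext t
        by_cases ht : t = s
        · subst ht; simp [hM', hc]
        · simp [hM', hy, ht]
      have hle' : ∀ r, M' r ≤ M r := fun r => by
        by_cases hr : r = s
        · subst hr; simpa [hM'] using hj.le
        · simp [hM', hr]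
      have hlt : ∑ i, M' i < ∑ i, M i :=
        sum_lt_sum (fun i _ => hle' i) ⟨s, mem_univ s, by simpa [hM'] using hj⟩
      have hI := ih _ hlt M' (y s) rfl
      simp only [show ∀ t, x t * q ^ (M' t + 1) = Function.update y s c t from congrFun hy'] at hI
      rw [sum_congr rfl fun k hk => symTerm_mul_qShifted q α b (y s) x (Function.update y s c) k
        (sum_le_sum fun i _ => mem_multiBox.1 hk i) (hzq s (M s + 1)), ← sum_mul,
        sum_congr rfl fun k _ => symTerm_swap q α b c x y s k] at hI
      rw [hPe, hQe, hK, sum_congr rfl fun k hk => symTerm_mul_qShifted q α b c x y k (hle k hk)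
        (hzq s (j + 1)), ← sum_mul]
      -- After the exchange the series already terminates at `M'`, so the terms outside the smaller
      -- box vanish.
      have hsub : ∑ k ∈ multiBox M', symTerm q α b c x y k
          = ∑ k ∈ multiBox M, symTerm q α b c x y k := by
        refine sum_subset (fun k hk => mem_multiBox.2 fun r => (mem_multiBox.1 hk r).trans (hle' r))
          fun k hk hk' => ?_
        obtain ⟨r, hr⟩ : ∃ r, M' r < k r := by
          by_contra! h; exact hk' (mem_multiBox.2 h)
        rw [← symTerm_swap q α b c x y s k]
        exact symTerm_eq_zero q α b (y s) x _ hr (congrFun hy' r).symm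
      rw [hsub] at hI
      -- The sums agree by symmetry; it remains that the closed form is invariant under the same
      -- exchange.
      have hsw := terminating_value_swap (α := α) hq (α * b) M s j
        (fun r m => by simpa [mul_assoc] using hzq r 1 m) hαbx
      rw [← hG, ← hc, ← hM'] at hsw
      change qShifted q (α * b * y s / q) _ / qShifted q (α * y s) _ * _ = _ at hsw
      have n1 : qShifted q (α * y s) (∑ r, M' r) ≠ 0 := hzq s (M s + 1) _
      have n2 : qShifted q (α * c) (∑ r, M r) ≠ 0 := hzq s (j + 1) _
      rw [eq_div_iff n1 |>.2 hI]
      have e : ∀ z, α * b / q * z = α * b * z / q := fun z => by ring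
      rw [e, e, mul_div_right_comm, hsw]
      field_simp
  rw [← hPe, hPQ, hQe]

end Terminating

/-! ### The terminating sum for every admissible `α` -/

section TerminatingHasSum

variable {q α b c : ℂ} {n : ℕ} {x : Fin n → ℂ}

lemma eq_of_eqOn_dense {f g : ℂ → ℂ} {S : Set ℂ} (hS : Dense S) {z : ℂ} (hf : ContinuousAt f z)
    (hg : ContinuousAt g z) (h : ∀ w ∈ S, f w = g w) : f z = g z := by
  have : (𝓝[S] z).NeBot := mem_closure_iff_nhdsWithin_neBot.1 (hS z)
  exact tendsto_nhds_unique_of_eventuallyEq (hf.mono_left nhdsWithin_le_nhds)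
    (hg.mono_left nhdsWithin_le_nhds) (eventually_nhdsWithin_of_forall h)

lemma continuousAt_qShifted_mul (q w z : ℂ) (m : ℕ) :
    ContinuousAt (fun β => qShifted q (β * w) m) z :=
  ((continuous_qShifted q m).comp (continuous_mul_const w)).continuousAt

lemma continuousAt_rogersCore (hαx : ∀ r, 1 - α * x r ≠ 0)
    (hαbx : ∀ r m, qShifted q (α * b * x r) m ≠ 0) (k : Fin n → ℕ) :
    ContinuousAt (fun β => rogersCore q β b x k) α := by
  unfold rogersCore
  have h1 : ContinuousAt (fun β => ∏ r, (1 - β * x r * q ^ (k r + ∑ i, k i)) / (1 - β * x r)) α :=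
    tendsto_finsetProd _ fun r _ => ContinuousAt.div (by fun_prop) (by fun_prop) (hαx r)
  have h2 : ContinuousAt (fun β => ∏ r, qShifted q (β * x r) (∑ i, k i)) α :=
    tendsto_finsetProd _ fun r _ => continuousAt_qShifted_mul _ _ _ _
  have h3 : ContinuousAt (fun β => ∏ r, (qShifted q (β * b * x r) (k r))⁻¹) α :=
    tendsto_finsetProd _ fun r _ => ContinuousAt.inv₀
      (by simpa only [mul_assoc] using continuousAt_qShifted_mul q (b * x r) α (k r)) (hαbx r _)
  fun_prop

theorem terminating_sum_cleared (hq : q ≠ 0) (hq1 : ‖q‖ < 1) (hb : b ≠ 0) (hx : ∀ r, x r ≠ 0)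
    (hgen : ∀ r s, r ≠ s → ∀ m : ℤ, x r / x s ≠ q ^ m) (M : Fin n → ℕ) (c : ℂ)
    (hαx : ∀ r, 1 - α * x r ≠ 0) (hαbx : ∀ r m, qShifted q (α * b * x r) m ≠ 0)
    (hαy : ∀ r m, qShifted q (α * (x r * q ^ (M r + 1))) m ≠ 0) :
    ∑ k ∈ multiBox M, rogersCore q α b x k
      * (∏ t, shiftedNumer q x k (x t * q ^ (M t + 1))
          / qShifted q (α * (x t * q ^ (M t + 1))) (∑ i, k i))
      * (shiftedNumer q x k c
          * qShifted q (α * q ^ (∑ i, k i) * c) ((∑ i, M i) - ∑ i, k i))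
      = qShifted q (α * b / q * c) (∑ i, M i)
        * ∏ r, qShifted q (α * q * x r) (M r) / qShifted q (α * b * x r) (M r) := by
  -- The excluded `α`: zero, and those for which some `α x_r` or `α b x_r` is an integer power of
  -- `q`. The set is countable, so its complement is dense.
  set E : Set ℂ := {0} ∪ ⋃ p : Fin n × ℤ, {q ^ p.2 / x p.1, q ^ p.2 / (b * x p.1)} with hE
  have hEc : E.Countable :=
    (Set.countable_singleton _).union (Set.countable_iUnion fun p => (Set.toFinite _).countable)
  refine eq_of_eqOn_dense (hEc.dense_compl ℂ) (f := fun α => ∑ k ∈ multiBox M, rogersCore q α b x k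
      * (∏ t, shiftedNumer q x k (x t * q ^ (M t + 1))
          / qShifted q (α * (x t * q ^ (M t + 1))) (∑ i, k i))
      * (shiftedNumer q x k c
          * qShifted q (α * q ^ (∑ i, k i) * c) ((∑ i, M i) - ∑ i, k i)))
    (g := fun α => qShifted q (α * b / q * c) (∑ i, M i)
        * ∏ r, qShifted q (α * q * x r) (M r) / qShifted q (α * b * x r) (M r)) ?_ ?_ ?_
  · refine tendsto_finsetSum _ fun k _ => ?_
    refine ContinuousAt.mul (ContinuousAt.mul (continuousAt_rogersCore hαx hαbx k)
      (tendsto_finsetProd _ fun t _ => ContinuousAt.div continuousAt_const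
        (continuousAt_qShifted_mul _ _ _ _) (hαy t _))) (continuousAt_const.mul ?_)
    simpa only [mul_assoc] using continuousAt_qShifted_mul q (q ^ (∑ i, k i) * c) α _
  · refine ContinuousAt.mul ?_ (tendsto_finsetProd _ fun r _ => ContinuousAt.div ?_ ?_ (hαbx r _))
    · simpa only [mul_assoc, div_eq_mul_inv] using
        continuousAt_qShifted_mul q (b * (q⁻¹ * c)) α (∑ i, M i)
    · simpa only [mul_assoc] using continuousAt_qShifted_mul q (q * x r) α (M r)
    · simpa only [mul_assoc] using continuousAt_qShifted_mul q (b * x r) α (M r)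
  · intro β hβ
    simp only [hE, Set.mem_compl_iff, Set.mem_union, Set.mem_singleton_iff, Set.mem_iUnion,
      Set.mem_insert_iff, not_or, not_exists, Prod.forall] at hβ
    refine terminating_sum_cleared_of_generic hq hq1 hb hx hgen hβ.1
      (fun r m h => (hβ.2 r m).1 (by have := hx r; field_simp; exact h))
      (fun r m => qShifted_ne_zero_of_ne_zpow (fun j h => (hβ.2 r j).2 ?_) m) M c
    have := hx r
    field_simp
    rw [← h]

/-- The argument of the series in terms of `y_r = a_r x_r`. -/
noncomputable def symArg (q α b c : ℂ) (x y : Fin n → ℂ) : ℂ :=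
  α * ((∏ r, y r) / ∏ r, x r) * b * c / q ^ (1 + n)

/-- The value of the series in terms of `y_r = a_r x_r`. -/
noncomputable def symValue (q α b c : ℂ) (x y : Fin n → ℂ) : ℂ :=
  qShiftedInf q (α * b * c / q) * qShiftedInf q (α * ((∏ r, y r) / ∏ r, x r) * c / q ^ n)
      / (qShiftedInf q (α * c) * qShiftedInf q (symArg q α b c x y))
    * ∏ r, qShiftedInf q (α * q * x r) * qShiftedInf q (α * y r * b / q)
        / (qShiftedInf q (α * b * x r) * qShiftedInf q (α * y r))

theorem hasSum_symTerm_terminating (hq : q ≠ 0) (hq1 : ‖q‖ < 1) (hb : b ≠ 0) (hx : ∀ r, x r ≠ 0)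
    (hgen : ∀ r s, r ≠ s → ∀ m : ℤ, x r / x s ≠ q ^ m) {y : Fin n → ℂ}
    (hy : ∀ r, ∃ m : ℕ, y r = x r * q ^ (m + 1)) (hαx : ∀ r, 1 - α * x r ≠ 0)
    (hαbx : ∀ r, qShiftedInf q (α * b * x r) ≠ 0) (hαy : ∀ r, qShiftedInf q (α * y r) ≠ 0)
    (hαc : qShiftedInf q (α * c) ≠ 0) (harg : qShiftedInf q (symArg q α b c x y) ≠ 0) :
    HasSum (symTerm q α b c x y) (symValue q α b c x y) := by
  choose M hM using hy
  obtain rfl : y = fun r => x r * q ^ (M r + 1) := funext hM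
  have hX : ∏ r, x r ≠ 0 := prod_ne_zero_iff.2 fun r _ => hx r
  have hS := terminating_sum_cleared hq hq1 hb hx hgen M c hαx
    (fun r => qShifted_ne_zero hq1 (hαbx r)) (fun r => qShifted_ne_zero hq1 (hαy r))
  have hαc' := qShifted_ne_zero hq1 hαc
  rw [sum_congr rfl fun k hk => symTerm_mul_qShifted q α b c x (fun r => x r * q ^ (M r + 1)) k
    (sum_le_sum fun i _ => mem_multiBox.1 hk i) hαc', ← sum_mul, ← eq_div_iff (hαc' _),
    mul_div_right_comm] at hS
  -- With this ratio every infinite product in the value pairs with another one shifted by `|M|` or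
  -- `M_r`, and each pair reduces to a finite product.
  have hY : (∏ r, x r * q ^ (M r + 1)) / ∏ r, x r = q ^ ((∑ r, M r) + n) := by
    rw [prod_mul_distrib, prod_pow_eq_pow_sum, sum_add_distrib, mul_div_cancel_left₀ _ hX]
    simp
  have hval : symValue q α b c x (fun r => x r * q ^ (M r + 1))
      = ∑ k ∈ multiBox M, symTerm q α b c x (fun r => x r * q ^ (M r + 1)) k := by
    have e1 : α * q ^ ((∑ r, M r) + n) * c / q ^ n = α * c * q ^ (∑ r, M r) := by
      rw [pow_add]; field_simp
    have e2 : α * q ^ ((∑ r, M r) + n) * b * c / q ^ (1 + n) = α * b * c / q * q ^ (∑ r, M r) := by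
      rw [pow_add, pow_add, pow_one]; field_simp
    rw [symArg, hY, e2] at harg
    rw [hS, symValue, symArg, hY, e1, e2, qShiftedInf_eq_mul hq1 (α * c) (∑ r, M r),
      qShiftedInf_eq_mul hq1 (α * b * c / q) (∑ r, M r)]
    have h1 := qShiftedInf_mul_pow_ne_zero hq1 hαc (∑ r, M r)
    have h2 := hαc' (∑ r, M r)
    have e3 : α * b / q * c = α * b * c / q := by ring
    rw [e3]
    congr 1
    · generalize qShiftedInf q (α * b * c / q * q ^ ∑ r, M r) = A at *
      generalize qShiftedInf q (α * c * q ^ ∑ r, M r) = B at *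
      field_simp
    · refine prod_congr rfl fun r _ => ?_
      have e4 : α * (x r * q ^ (M r + 1)) = α * q * x r * q ^ M r := by ring
      have e5 : α * (x r * q ^ (M r + 1)) * b / q = α * b * x r * q ^ M r := by field_simp; ring
      have h3 := hαy r
      have h4 := hαbx r
      simp only [e4] at h3
      rw [qShiftedInf_eq_mul hq1 _ (M r)] at h4
      have h5 := left_ne_zero_of_mul h4
      have h6 := right_ne_zero_of_mul h4
      rw [e5, e4, qShiftedInf_eq_mul hq1 (α * q * x r) (M r),
        qShiftedInf_eq_mul hq1 (α * b * x r) (M r)]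
      generalize qShiftedInf q (α * b * x r * q ^ M r) = A at *
      generalize qShiftedInf q (α * q * x r * q ^ M r) = B at *
      field_simp
  rw [hval]
  refine hasSum_sum_of_ne_finset_zero fun k hk => ?_
  obtain ⟨r, hr⟩ : ∃ r, M r < k r := by
    by_contra! h; exact hk (mem_multiBox.2 h)
  exact symTerm_eq_zero q α b c x _ hr rfl

end TerminatingHasSum

/-! ### Geometric bounds for the summand -/

section Convergence

variable {q α b c : ℂ} {n : ℕ} {x : Fin n → ℂ}

lemma exists_norm_prod_le {ι κ : Type*} (s : Finset ι) (f : ι → κ → ℂ)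
    (h : ∀ i, ∃ C > 0, ∀ k, ‖f i k‖ ≤ C) : ∃ C > 0, ∀ k, ‖∏ i ∈ s, f i k‖ ≤ C := by
  choose C hC hf using h
  refine ⟨∏ i ∈ s, C i, prod_pos fun i _ => hC i, fun k => ?_⟩
  rw [norm_prod]
  exact prod_le_prod (fun i _ => norm_nonneg _) fun i _ => hf i k

lemma exists_norm_mul_le {κ : Type*} {f g : κ → ℂ} (hf : ∃ C > 0, ∀ k, ‖f k‖ ≤ C)
    (hg : ∃ C > 0, ∀ k, ‖g k‖ ≤ C) : ∃ C > 0, ∀ k, ‖f k * g k‖ ≤ C := by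
  obtain ⟨C, hC, hf⟩ := hf
  obtain ⟨D, hD, hg⟩ := hg
  refine ⟨C * D, by positivity, fun k => ?_⟩
  rw [norm_mul]
  exact mul_le_mul (hf k) (hg k) (norm_nonneg _) hC.le

lemma norm_pow_le_one (hq1 : ‖q‖ < 1) (m : ℕ) : ‖q ^ m‖ ≤ 1 := by
  rw [norm_pow]; exact pow_le_one₀ (norm_nonneg _) hq1.le

lemma exists_norm_one_sub_mul_pow_le {κ : Type*} (hq1 : ‖q‖ < 1) (z : ℂ) (e : κ → ℕ) (d : ℂ) :
    ∃ C > 0, ∀ k, ‖(1 - z * q ^ e k) / d‖ ≤ C := by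
  -- The added `1` keeps the bound positive also for `d = 0`, where the quotient is `0`.
  refine ⟨(1 + ‖z‖) / ‖d‖ + 1, by positivity, fun k => ?_⟩
  rw [norm_div]
  have h : ‖1 - z * q ^ e k‖ ≤ 1 + ‖z‖ := by
    refine (norm_sub_le _ _).trans ?_
    rw [norm_one, norm_mul]
    have := mul_le_mul_of_nonneg_left (norm_pow_le_one hq1 (e k)) (norm_nonneg z)
    linarith
  have := div_le_div_of_nonneg_right h (norm_nonneg d)
  linarith

/-- The power of `q` supplies `q ^ k_s` for each pair `r < s`, which removes the negative exponents:
the numerators become `q ^ k_s - q ^ k_r x_r / x_s`. -/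
lemma exists_norm_vandermonde_le (hq : ‖q‖ < 1) (hq0 : q ≠ 0) :
    ∃ C > 0, ∀ k : Fin n → ℕ,
      ‖vandermondeFactor q x k * q ^ (∑ r : Fin n, (r : ℕ) * k r)‖ ≤ C := by
  have h : ∀ k : Fin n → ℕ, vandermondeFactor q x k * q ^ (∑ r : Fin n, (r : ℕ) * k r)
      = ∏ r, ∏ s ∈ Ioi r, (q ^ k s - q ^ k r * (x r / x s)) / (1 - x r / x s) := fun k => by
    rw [pow_sum_index_mul, vandermondeFactor, ← prod_mul_distrib]
    refine prod_congr rfl fun r _ => ?_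
    rw [← prod_mul_distrib]
    refine prod_congr rfl fun s _ => ?_
    rw [zpow_sub₀ hq0, zpow_natCast, zpow_natCast, div_mul_eq_mul_div]
    congr 1
    have := pow_ne_zero (k s) hq0
    generalize x r / x s = u
    field_simp
  simp only [h]
  refine exists_norm_prod_le _ _ fun r => exists_norm_prod_le _ _ fun s => ?_
  refine ⟨(1 + ‖x r / x s‖) / ‖1 - x r / x s‖ + 1, by positivity, fun k => ?_⟩
  rw [norm_div]
  have h : ‖q ^ k s - q ^ k r * (x r / x s)‖ ≤ 1 + ‖x r / x s‖ := by
    refine (norm_sub_le _ _).trans ?_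
    rw [norm_mul]
    have := mul_le_mul_of_nonneg_right (norm_pow_le_one hq (k r)) (norm_nonneg (x r / x s))
    have := norm_pow_le_one hq (k s)
    linarith
  have := div_le_div_of_nonneg_right h (norm_nonneg (1 - x r / x s))
  linarith

lemma exists_norm_rogersCore_le (hq0 : q ≠ 0) (hq : ‖q‖ < 1)
    (hqx : ∀ r s, qShiftedInf q (q * x r / x s) ≠ 0)
    (hαbx : ∀ r, qShiftedInf q (α * b * x r) ≠ 0) :
    ∃ C > 0, ∀ k : Fin n → ℕ, ‖rogersCore q α b x k‖
      ≤ C * ‖α * b / ((∏ r, x r) * q ^ (1 + n))‖ ^ (∑ i, k i) := by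
  have hb' : ∀ z : ℂ, ∀ e : (Fin n → ℕ) → ℕ, ∃ C > 0, ∀ k, ‖qShifted q z (e k)‖ ≤ C := fun z e =>
    (exists_norm_qShifted_le hq z).imp fun C h => ⟨h.1, fun k => h.2 _⟩
  have hi' : ∀ z : ℂ, qShiftedInf q z ≠ 0 → ∀ e : (Fin n → ℕ) → ℕ,
      ∃ C > 0, ∀ k, ‖(qShifted q z (e k))⁻¹‖ ≤ C := fun z hz e =>
    (exists_norm_inv_qShifted_le hq hz).imp fun C h => ⟨h.1, fun k => h.2 _⟩
  obtain ⟨C, hC, h⟩ := exists_norm_mul_le (exists_norm_mul_le (exists_norm_mul_le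
    (exists_norm_mul_le (exists_norm_mul_le (exists_norm_vandermonde_le (n := n) (x := x) hq hq0)
      (exists_norm_prod_le univ _ fun r => exists_norm_prod_le univ _ fun s =>
        hi' (q * x r / x s) (hqx r s) fun k => k r))
      (exists_norm_prod_le univ _ fun r => exists_norm_one_sub_mul_pow_le hq (α * x r)
        (fun k : Fin n → ℕ => k r + ∑ i, k i) (1 - α * x r)))
      (exists_norm_prod_le univ _ fun r => hb' (α * x r) fun k => ∑ i, k i))
      (hb' (q / b) fun k => ∑ i, k i))
      (exists_norm_prod_le univ _ fun r => hi' (α * b * x r) (hαbx r) fun k => k r)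
  refine ⟨C, hC, fun k => ?_⟩
  rw [rogersCore, norm_mul, norm_pow]
  exact mul_le_mul_of_nonneg_right (h k) (by positivity)

lemma exists_norm_shiftedNumer_le (hq : ‖q‖ < 1) (x : Fin n → ℂ) {ρ : ℝ} (hρ : 0 < ρ) :
    ∃ C > 0, ∀ k : Fin n → ℕ, ∀ z : ℂ, ‖z‖ ≤ ρ →
      ‖shiftedNumer q x k z‖ ≤ C * ρ ^ (∑ i, k i) := by
  have h1 : ∀ r, ∃ C > 0, ∀ m : ℕ, ∀ z : ℂ, ‖z‖ ≤ ρ →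
      ‖∏ j ∈ range m, (z - x r * q ^ (j + 1))‖ ≤ C * ρ ^ m := by
    intro r
    -- Each factor is at most `ρ (1 + ‖x_r‖ ‖q‖ ^ (j + 1) / ρ)`, so the product is `ρ ^ m` times a
    -- bounded shifted factorial with base `‖q‖`.
    obtain ⟨C, hC, h⟩ := exists_norm_qShifted_le (q := (‖q‖ : ℂ)) (by simpa using hq)
      (-(‖x r‖ * ‖q‖ / ρ : ℝ))
    refine ⟨C, hC, fun m z hz => ?_⟩
    refine le_trans ?_ (mul_le_mul_of_nonneg_right (h m) (by positivity))
    have e : ρ ^ m = ∏ _j ∈ range m, ρ := by simp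
    rw [norm_prod, qShifted, norm_prod, e, ← prod_mul_distrib]
    refine prod_le_prod (fun _ _ => norm_nonneg _) fun j _ => ?_
    have e2 : (1 - -(((‖x r‖ * ‖q‖ / ρ : ℝ) : ℂ)) * (‖q‖ : ℂ) ^ j)
        = ((1 + ‖x r‖ * ‖q‖ / ρ * ‖q‖ ^ j : ℝ) : ℂ) := by push_cast; ring
    rw [e2, Complex.norm_real, Real.norm_of_nonneg (by positivity)]
    have e3 : (1 + ‖x r‖ * ‖q‖ / ρ * ‖q‖ ^ j) * ρ = ρ + ‖x r‖ * ‖q‖ ^ (j + 1) := by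
      field_simp; ring
    rw [e3]
    refine (norm_sub_le _ _).trans ?_
    rw [norm_mul, norm_pow]
    linarith
  choose C hC h using h1
  refine ⟨∏ r, C r, prod_pos fun r _ => hC r, fun k z hz => ?_⟩
  rw [shiftedNumer, norm_prod, ← prod_pow_eq_pow_sum, ← prod_mul_distrib]
  exact prod_le_prod (fun _ _ => norm_nonneg _) fun r _ => h r (k r) z hz

end Convergence

/-! ### Analytic continuation in the parameters `y_s` -/

section Continuation

variable {q α b c : ℂ} {n : ℕ} {x y : Fin n → ℂ}

/-- The summand at `y_s = z`, multiplied by `(α z; q)_∞`, as an entire function of `z`. -/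
noncomputable def entireTerm (q α b c : ℂ) (x y : Fin n → ℂ) (s : Fin n) (k : Fin n → ℕ)
    (z : ℂ) : ℂ :=
  rogersCore q α b x k
    * (∏ t ∈ univ.erase s, shiftedNumer q x k (y t) * (qShifted q (α * y t) (∑ i, k i))⁻¹)
    * (shiftedNumer q x k c * (qShifted q (α * c) (∑ i, k i))⁻¹)
    * (shiftedNumer q x k z * qShiftedInf q (α * z * q ^ (∑ i, k i)))

/-- The value of the series at `y_s = z`, multiplied by `(α z; q)_∞`. -/
noncomputable def entireValue (q α b c : ℂ) (x y : Fin n → ℂ) (s : Fin n) (z : ℂ) : ℂ :=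
  qShiftedInf q (α * b * c / q)
      * qShiftedInf q (α * (z * (∏ r ∈ univ.erase s, y r) / ∏ r, x r) * c / q ^ n)
      / (qShiftedInf q (α * c)
        * qShiftedInf q (α * (z * (∏ r ∈ univ.erase s, y r) / ∏ r, x r) * b * c / q ^ (1 + n)))
    * ((qShiftedInf q (α * q * x s) * qShiftedInf q (α * z * b / q) / qShiftedInf q (α * b * x s))
      * ∏ r ∈ univ.erase s, qShiftedInf q (α * q * x r) * qShiftedInf q (α * y r * b / q)
        / (qShiftedInf q (α * b * x r) * qShiftedInf q (α * y r)))

lemma symTerm_update_mul (hq : ‖q‖ < 1) (s : Fin n) (k : Fin n → ℕ) {z : ℂ}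
    (hz : qShiftedInf q (α * z) ≠ 0) :
    symTerm q α b c x (Function.update y s z) k * qShiftedInf q (α * z)
      = entireTerm q α b c x y s k z := by
  have h := qShifted_ne_zero hq hz (∑ i, k i)
  rw [symTerm, entireTerm,
    prod_update_eq (fun z => shiftedNumer q x k z / qShifted q (α * z) (∑ i, k i)),
    qShiftedInf_eq_mul hq (α * z) (∑ i, k i)]
  simp only [← div_eq_mul_inv]
  generalize qShiftedInf q (α * z * q ^ (∑ i, k i)) = A
  generalize ∏ t ∈ univ.erase s, shiftedNumer q x k (y t) / qShifted q (α * y t) (∑ i, k i) = B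
  generalize shiftedNumer q x k c / qShifted q (α * c) (∑ i, k i) = C
  field_simp

lemma prod_update_self_mul (s : Fin n) (z : ℂ) :
    ∏ r, Function.update y s z r = z * ∏ r ∈ univ.erase s, y r := prod_update_eq id y s z

lemma symValue_update_mul (s : Fin n) {z : ℂ} (hz : qShiftedInf q (α * z) ≠ 0) :
    symValue q α b c x (Function.update y s z) * qShiftedInf q (α * z)
      = entireValue q α b c x y s z := by
  rw [symValue, entireValue, symArg, prod_update_self_mul, ← mul_prod_erase univ (fun r =>
      qShiftedInf q (α * q * x r) * qShiftedInf q (α * Function.update y s z r * b / q)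
        / (qShiftedInf q (α * b * x r) * qShiftedInf q (α * Function.update y s z r))) (mem_univ s),
    Function.update_self, mul_assoc]
  congr 1
  have hupd : ∀ r ∈ univ.erase s, qShiftedInf q (α * q * x r)
        * qShiftedInf q (α * Function.update y s z r * b / q)
        / (qShiftedInf q (α * b * x r) * qShiftedInf q (α * Function.update y s z r))
      = qShiftedInf q (α * q * x r) * qShiftedInf q (α * y r * b / q)
        / (qShiftedInf q (α * b * x r) * qShiftedInf q (α * y r)) := fun r hr => by
    rw [Function.update_of_ne (ne_of_mem_erase hr)]
  rw [prod_congr rfl hupd, mul_right_comm]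
  congr 1
  rw [div_mul_eq_mul_div, mul_div_mul_right _ _ hz]

lemma differentiable_entireTerm (hq : ‖q‖ < 1) (s : Fin n) (k : Fin n → ℕ) :
    Differentiable ℂ (entireTerm q α b c x y s k) := by
  have h1 : Differentiable ℂ (shiftedNumer q x k) := by unfold shiftedNumer; fun_prop
  have h2 : Differentiable ℂ fun z => qShiftedInf q (α * z * q ^ (∑ i, k i)) :=
    (differentiable_qShiftedInf hq).comp (by fun_prop)
  unfold entireTerm
  fun_prop

lemma differentiableOn_entireValue (hq : ‖q‖ < 1) (hαc : qShiftedInf q (α * c) ≠ 0) (s : Fin n)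
    {U : Set ℂ}
    (hU : ∀ z ∈ U, ‖α * (z * (∏ r ∈ univ.erase s, y r) / ∏ r, x r) * b * c / q ^ (1 + n)‖ < 1) :
    DifferentiableOn ℂ (entireValue q α b c x y s) U := by
  have hd : ∀ f : ℂ → ℂ, Differentiable ℂ f → Differentiable ℂ fun z => qShiftedInf q (f z) :=
    fun f hf => (differentiable_qShiftedInf hq).comp hf
  have h1 := hd (fun z => α * (z * (∏ r ∈ univ.erase s, y r) / ∏ r, x r) * c / q ^ n) (by fun_prop)
  have h2 := hd (fun z => α * (z * (∏ r ∈ univ.erase s, y r) / ∏ r, x r) * b * c / q ^ (1 + n))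
    (by fun_prop)
  have h3 := hd (fun z => α * z * b / q) (by fun_prop)
  unfold entireValue
  refine DifferentiableOn.mul (DifferentiableOn.div (by fun_prop) (by fun_prop) fun z hz => ?_)
    (by fun_prop)
  exact mul_ne_zero hαc (qShiftedInf_ne_zero_of_norm_lt_one hq (hU z hz))

lemma exists_norm_qShiftedInf_le (hq : ‖q‖ < 1) (α : ℂ) (ρ : ℝ) :
    ∃ C > 0, ∀ m : ℕ, ∀ z : ℂ, ‖z‖ ≤ ρ → ‖qShiftedInf q (α * z * q ^ m)‖ ≤ C := by
  obtain ⟨C, hC⟩ := (isCompact_closedBall (0 : ℂ) (‖α‖ * ρ)).exists_bound_of_continuousOn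
    (differentiable_qShiftedInf hq).continuous.continuousOn
  refine ⟨max C 1, by positivity, fun m z hz => (hC _ ?_).trans (le_max_left _ _)⟩
  rw [mem_closedBall_zero_iff, norm_mul, norm_mul]
  have h1 : ‖α‖ * ‖z‖ ≤ ‖α‖ * ρ := by gcongr
  exact (mul_le_of_le_one_right (by positivity) (norm_pow_le_one hq m)).trans h1

/-- Uniformity in `z` provides the Weierstrass majorant that makes the sum analytic on the disc of
radius `ρ`, when the ratio is below `1`. -/
lemma exists_norm_entireTerm_le (hq0 : q ≠ 0) (hq : ‖q‖ < 1)
    (hqx : ∀ r s, qShiftedInf q (q * x r / x s) ≠ 0)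
    (hαbx : ∀ r, qShiftedInf q (α * b * x r) ≠ 0) (s : Fin n) (hc : c ≠ 0)
    (hαc : qShiftedInf q (α * c) ≠ 0) (hy : ∀ t, y t ≠ 0)
    (hαy : ∀ t, qShiftedInf q (α * y t) ≠ 0) {ρ : ℝ} (hρ : 0 < ρ) :
    ∃ C > 0, ∀ k : Fin n → ℕ, ∀ z : ℂ, ‖z‖ ≤ ρ → ‖entireTerm q α b c x y s k z‖
      ≤ C * (‖α * ((∏ r ∈ univ.erase s, y r) / ∏ r, x r) * b * c / q ^ (1 + n)‖ * ρ)
          ^ (∑ i, k i) := by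
  obtain ⟨C₁, hC₁, h₁⟩ := exists_norm_rogersCore_le (n := n) hq0 hq hqx hαbx
  have hfac : ∀ w : ℂ, w ≠ 0 → qShiftedInf q (α * w) ≠ 0 → ∃ C > 0, ∀ k : Fin n → ℕ,
      ‖shiftedNumer q x k w * (qShifted q (α * w) (∑ i, k i))⁻¹‖ ≤ C * ‖w‖ ^ (∑ i, k i) := by
    intro w hw hαw
    obtain ⟨C, hC, h⟩ := exists_norm_shiftedNumer_le hq x (norm_pos_iff.2 hw)
    obtain ⟨D, hD, h'⟩ := exists_norm_inv_qShifted_le hq hαw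
    refine ⟨C * D, by positivity, fun k => ?_⟩
    rw [norm_mul, mul_right_comm]
    exact mul_le_mul (h k w le_rfl) (h' _) (norm_nonneg _) (by positivity)
  choose C₂ hC₂ h₂ using fun t => hfac (y t) (hy t) (hαy t)
  obtain ⟨C₃, hC₃, h₃⟩ := hfac c hc hαc
  obtain ⟨C₄, hC₄, h₄⟩ := exists_norm_shiftedNumer_le hq x hρ
  obtain ⟨C₅, hC₅, h₅⟩ := exists_norm_qShiftedInf_le hq α ρ
  have hC₂' : 0 < ∏ t ∈ univ.erase s, C₂ t := prod_pos fun t _ => hC₂ t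
  refine ⟨C₁ * (∏ t ∈ univ.erase s, C₂ t) * C₃ * (C₄ * C₅), by positivity, fun k z hz => ?_⟩
  have hprod : ‖∏ t ∈ univ.erase s, shiftedNumer q x k (y t)
      * (qShifted q (α * y t) (∑ i, k i))⁻¹‖
      ≤ (∏ t ∈ univ.erase s, C₂ t) * (∏ t ∈ univ.erase s, ‖y t‖) ^ (∑ i, k i) := by
    rw [norm_prod, ← prod_pow, ← prod_mul_distrib]
    exact prod_le_prod (fun _ _ => norm_nonneg _) fun t _ => h₂ t k
  have he : ‖α * ((∏ r ∈ univ.erase s, y r) / ∏ r, x r) * b * c / q ^ (1 + n)‖ * ρ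
      = ‖α * b / ((∏ r, x r) * q ^ (1 + n))‖ * (∏ t ∈ univ.erase s, ‖y t‖) * ‖c‖ * ρ := by
    rw [← norm_prod, ← norm_mul, ← norm_mul]
    congr 2
    ring
  rw [he, mul_pow, mul_pow, mul_pow, entireTerm, norm_mul, norm_mul (shiftedNumer q x k z),
    norm_mul (rogersCore q α b x k * _), norm_mul (rogersCore q α b x k)]
  calc _ ≤ (C₁ * ‖α * b / ((∏ r, x r) * q ^ (1 + n))‖ ^ (∑ i, k i))
        * ((∏ t ∈ univ.erase s, C₂ t) * (∏ t ∈ univ.erase s, ‖y t‖) ^ (∑ i, k i))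
        * (C₃ * ‖c‖ ^ (∑ i, k i)) * ((C₄ * ρ ^ (∑ i, k i)) * C₅) := by
        have := h₁ k
        have := h₃ k
        have := h₄ k z hz
        have := h₅ (∑ i, k i) z hz
        gcongr
    _ = _ := by ring

theorem hasSum_symTerm_of_eventually (hq0 : q ≠ 0) (hq : ‖q‖ < 1) (hx : ∀ r, x r ≠ 0)
    (hqx : ∀ r s, qShiftedInf q (q * x r / x s) ≠ 0)
    (hαbx : ∀ r, qShiftedInf q (α * b * x r) ≠ 0) (s : Fin n) (hc : c ≠ 0)
    (hαc : qShiftedInf q (α * c) ≠ 0) (hy : ∀ t, y t ≠ 0)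
    (hαy : ∀ t, qShiftedInf q (α * y t) ≠ 0) (harg : ‖symArg q α b c x y‖ < 1)
    (h : ∀ m : ℕ, qShiftedInf q (α * (x s * q ^ (m + 1))) ≠ 0 →
      ‖symArg q α b c x (Function.update y s (x s * q ^ (m + 1)))‖ < 1 →
      HasSum (symTerm q α b c x (Function.update y s (x s * q ^ (m + 1))))
        (symValue q α b c x (Function.update y s (x s * q ^ (m + 1))))) :
    HasSum (symTerm q α b c x y) (symValue q α b c x y) := by
  set δ := α * ((∏ r ∈ univ.erase s, y r) / ∏ r, x r) * b * c / q ^ (1 + n) with hδ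
  have harg' : ∀ z, symArg q α b c x (Function.update y s z) = δ * z := fun z => by
    rw [symArg, prod_update_self_mul, hδ]; ring
  have hself : Function.update y s (y s) = y := Function.update_eq_self s y
  -- The radius slightly exceeds `‖y s‖`: the disc contains both `y s` and the accumulation point
  -- `0`, while the geometric ratio `‖δ‖ * ρ` stays below `1`.
  obtain ⟨ρ, hρ1, hρ⟩ : ∃ ρ, ‖δ‖ * ρ < 1 ∧ ‖y s‖ < ρ := by
    have h0 : ‖δ‖ * ‖y s‖ < 1 := by rwa [← norm_mul, ← harg', hself]
    have := ((continuous_const.mul continuous_id : Continuous fun t : ℝ => ‖δ‖ * t).tendsto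
      ‖y s‖).eventually_lt_const h0
    exact ((this.filter_mono nhdsWithin_le_nhds).and
      (self_mem_nhdsWithin : Set.Ioi ‖y s‖ ∈ 𝓝[>] ‖y s‖)).exists
  have hρ0 : 0 < ρ := (norm_nonneg _).trans_lt hρ
  obtain ⟨C, hC, hbd⟩ := exists_norm_entireTerm_le hq0 hq hqx hαbx s hc hαc hy hαy hρ0
  have hsum := (summable_pow_sum (mul_nonneg (norm_nonneg δ) hρ0.le) hρ1 n).mul_left C
  have hF : DifferentiableOn ℂ (fun z => ∑' k, entireTerm q α b c x y s k z) (Metric.ball 0 ρ) :=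
    Complex.differentiableOn_tsum_of_summable_norm hsum
      (fun k => (differentiable_entireTerm hq s k).differentiableOn) Metric.isOpen_ball
      fun k z hz => hbd k z (mem_ball_zero_iff.1 hz).le
  have hδz : ∀ z, α * (z * (∏ r ∈ univ.erase s, y r) / ∏ r, x r) * b * c / q ^ (1 + n) = δ * z :=
    fun z => by rw [hδ]; ring
  have hδlt : ∀ z ∈ Metric.ball (0 : ℂ) ρ, ‖δ * z‖ < 1 := fun z hz => by
    rw [norm_mul]
    exact (mul_le_mul_of_nonneg_left (mem_ball_zero_iff.1 hz).le (norm_nonneg _)).trans_lt hρ1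
  have hR : DifferentiableOn ℂ (entireValue q α b c x y s) (Metric.ball 0 ρ) :=
    differentiableOn_entireValue hq hαc s fun z hz => by rw [hδz]; exact hδlt z hz
  have hlim : Tendsto (fun m : ℕ => x s * q ^ (m + 1)) atTop (𝓝 0) := by
    simpa using ((tendsto_pow_atTop_nhds_zero_of_norm_lt_one hq).comp
      (tendsto_add_atTop_nat 1)).const_mul (x s)
  have hlim' : Tendsto (fun m : ℕ => x s * q ^ (m + 1)) atTop (𝓝[≠] 0) :=
    tendsto_nhdsWithin_iff.2 ⟨hlim, Eventually.of_forall fun m => by simp [hx s, hq0]⟩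
  have hev : ∀ᶠ m : ℕ in atTop, (∑' k, entireTerm q α b c x y s k (x s * q ^ (m + 1)))
      = entireValue q α b c x y s (x s * q ^ (m + 1)) := by
    have hαlim : Tendsto (fun m : ℕ => ‖α * (x s * q ^ (m + 1))‖) atTop (𝓝 0) := by
      simpa using (hlim.const_mul α).norm
    filter_upwards [hαlim.eventually_lt_const one_pos,
      hlim (Metric.ball_mem_nhds 0 hρ0)] with m hm1 hm2
    have hm := qShiftedInf_ne_zero_of_norm_lt_one hq hm1
    have hs := (h m hm (by rw [harg']; exact hδlt _ hm2)).mul_right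
      (qShiftedInf q (α * (x s * q ^ (m + 1))))
    rw [symValue_update_mul s hm] at hs
    simp only [symTerm_update_mul hq s _ hm] at hs
    exact hs.tsum_eq
  have heq := (hF.analyticOnNhd Metric.isOpen_ball).eqOn_of_preconnected_of_frequently_eq
    (hR.analyticOnNhd Metric.isOpen_ball) (convex_ball (0 : ℂ) ρ).isPreconnected
    (Metric.mem_ball_self hρ0) (hlim'.frequently hev.frequently)
  have hys : y s ∈ Metric.ball (0 : ℂ) ρ := mem_ball_zero_iff.2 hρ
  have hsy : Summable fun k => entireTerm q α b c x y s k (y s) :=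
    Summable.of_norm_bounded hsum fun k => hbd k (y s) hρ.le
  have hfin : HasSum (fun k => entireTerm q α b c x y s k (y s))
      (entireValue q α b c x y s (y s)) := by
    have h1 := hsy.hasSum
    rwa [show ∑' k, entireTerm q α b c x y s k (y s) = _ from heq hys] at h1
  -- The factor `(α y_s)_∞` is nonzero and is divided out again.
  simp only [← symTerm_update_mul hq s _ (hαy s), ← symValue_update_mul s (hαy s), hself] at hfin
  simpa [mul_assoc, mul_inv_cancel₀ (hαy s)] using hfin.mul_right (qShiftedInf q (α * y s))⁻¹

theorem hasSum_symTerm (hq0 : q ≠ 0) (hq : ‖q‖ < 1) (hb : b ≠ 0) (hx : ∀ r, x r ≠ 0)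
    (hgen : ∀ r s, r ≠ s → ∀ m : ℤ, x r / x s ≠ q ^ m)
    (hqx : ∀ r s, qShiftedInf q (q * x r / x s) ≠ 0) (hαx : ∀ r, 1 - α * x r ≠ 0)
    (hαbx : ∀ r, qShiftedInf q (α * b * x r) ≠ 0) (hc : c ≠ 0)
    (hαc : qShiftedInf q (α * c) ≠ 0) (hy : ∀ t, y t ≠ 0)
    (hαy : ∀ t, qShiftedInf q (α * y t) ≠ 0) (harg : ‖symArg q α b c x y‖ < 1) :
    HasSum (symTerm q α b c x y) (symValue q α b c x y) := by
  -- `T` contains the indices at which `y` need not have the terminating form; the other entries are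
  -- `x_r q ^ (m + 1)`.
  suffices H : ∀ T : Finset (Fin n), ∀ y : Fin n → ℂ, (∀ t, y t ≠ 0) →
      (∀ t, qShiftedInf q (α * y t) ≠ 0) → ‖symArg q α b c x y‖ < 1 →
      (∀ r ∉ T, ∃ m : ℕ, y r = x r * q ^ (m + 1)) →
      HasSum (symTerm q α b c x y) (symValue q α b c x y) from
    H univ y hy hαy harg fun r hr => absurd (mem_univ r) hr
  intro T
  induction T using Finset.induction_on with
  | empty =>
    intro y _ hαy harg hT
    exact hasSum_symTerm_terminating hq0 hq hb hx hgen (fun r => hT r (notMem_empty r)) hαx hαbx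
      hαy hαc (qShiftedInf_ne_zero_of_norm_lt_one hq harg)
  | insert s T _ ih =>
    intro y hy hαy harg hT
    refine hasSum_symTerm_of_eventually hq0 hq hx hqx hαbx s hc hαc hy hαy harg
      fun m hm hargm => ih _ ?_ ?_ hargm ?_
    · intro t
      by_cases ht : t = s
      · subst ht; simp [hx, hq0]
      · simpa [ht] using hy t
    · intro t
      by_cases ht : t = s
      · subst ht; simpa using hm
      · simpa [ht] using hαy t
    · intro t htT
      by_cases ht : t = s
      · subst ht; exact ⟨m, by simp⟩
      · simpa [ht] using hT t (by simp [ht, htT])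

end Continuation

/-! ### Return to the original parameters -/

/-- Negative powers are excluded by `(q x_r / x_s)_k`, positive ones by the same factor with `r` and
`s` exchanged, and the power `0` by the Vandermonde denominators. -/
lemma div_ne_zpow_of_qShifted_ne_zero {n : ℕ} {q : ℂ} {x : Fin n → ℂ} (hq0 : q ≠ 0)
    (hx : ∀ r, x r ≠ 0) (hxx : ∀ r s, r < s → 1 - x r / x s ≠ 0)
    (hqx : ∀ r s, ∀ m : ℕ, qShifted q (q * x r / x s) m ≠ 0) (r s : Fin n) (hrs : r ≠ s) (m : ℤ) :
    x r / x s ≠ q ^ m := by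
  have hneg : ∀ r s, ∀ j : ℕ, x r / x s ≠ q ^ (-((j : ℤ) + 1)) := fun r s j h => by
    refine hqx r s (j + 1) (prod_eq_zero (mem_range.2 (Nat.lt_succ_self j)) ?_)
    rw [mul_div_assoc, h, zpow_neg, zpow_add₀ hq0, zpow_natCast, zpow_one]
    field_simp
    ring
  intro h
  rcases lt_trichotomy m 0 with hm | rfl | hm
  · obtain ⟨j, hj⟩ : ∃ j : ℕ, m = -((j : ℤ) + 1) := ⟨(-m - 1).toNat, by omega⟩
    exact hneg r s j (hj ▸ h)
  · rw [zpow_zero, div_eq_one_iff_eq (hx s)] at h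
    rcases lt_or_gt_of_ne hrs with hlt | hlt
    · exact hxx r s hlt (by rw [h, div_self (hx s), sub_self])
    · exact hxx s r hlt (by rw [h, div_self (hx s), sub_self])
  · obtain ⟨j, hj⟩ : ∃ j : ℕ, m = (j : ℤ) + 1 := ⟨(m - 1).toNat, by omega⟩
    refine hneg s r j ?_
    rw [zpow_neg, ← hj, ← h, inv_div]

/-- For complex series `HasSum` is unconditional, hence absolute, convergence, so it contains the
convergence claim. -/
theorem mainTheorem6 (n : ℕ) (q α b c : ℂ) (x a : Fin n → ℂ)
    (hq0 : q ≠ 0) (hq1 : ‖q‖ < 1)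
    -- either the argument has modulus less than one, or the series terminates
    (hconv : ‖rogersArg q α b c a‖ < 1 ∨
      ∃ N : Fin n → ℕ, (∀ r, 1 ≤ N r) ∧ ∀ r, a r = q ^ N r)
    -- no denominator vanishes; those of the form `(z; q)_m` whose `(z; q)_∞` also occurs
    -- as a denominator are covered by the latter
    (hb : b ≠ 0) (hc : c ≠ 0) (ha : ∀ r, a r ≠ 0) (hx : ∀ r, x r ≠ 0)
    (hxx : ∀ r s, r < s → 1 - x r / x s ≠ 0)
    (hqx : ∀ r s, ∀ m : ℕ, qShifted q (q * x r / x s) m ≠ 0)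
    (hαx : ∀ r, 1 - α * x r ≠ 0)
    (hαax : ∀ r, qShiftedInf q (α * x r * a r) ≠ 0)
    (hαbx : ∀ r, qShiftedInf q (α * b * x r) ≠ 0)
    (hαc : qShiftedInf q (α * c) ≠ 0)
    (harg : qShiftedInf q (rogersArg q α b c a) ≠ 0) :
    HasSum (fun k : Fin n → ℕ => rogersTerm q α b c x a k)
      (qShiftedInf q (α * b * c / q) * qShiftedInf q (α * (∏ r, a r) * c / q ^ n)
          / (qShiftedInf q (α * c) * qShiftedInf q (rogersArg q α b c a))
        * ∏ r, qShiftedInf q (α * q * x r) * qShiftedInf q (α * a r * b * x r / q)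
            / (qShiftedInf q (α * b * x r) * qShiftedInf q (α * x r * a r))) := by
  have hX : ∏ r, x r ≠ 0 := prod_ne_zero_iff.2 fun r _ => hx r
  set y : Fin n → ℂ := fun r => x r * a r with hy
  have hY : (∏ r, y r) / ∏ r, x r = ∏ r, a r := by
    rw [prod_mul_distrib, mul_div_cancel_left₀ _ hX]
  have hA : symArg q α b c x y = rogersArg q α b c a := by rw [symArg, hY, rogersArg]
  have hαy : ∀ r, qShiftedInf q (α * y r) ≠ 0 := fun r => by
    simpa only [hy, ← mul_assoc] using hαax r
  have hgen := div_ne_zpow_of_qShifted_ne_zero hq0 hx hxx hqx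
  have key : HasSum (symTerm q α b c x y) (symValue q α b c x y) := by
    rcases hconv with hlt | ⟨N, hN, haN⟩
    · exact hasSum_symTerm hq0 hq1 hb hx hgen (fun r s => qShiftedInf_ne_zero hq1 (hqx r s)) hαx
        hαbx hc hαc (fun t => mul_ne_zero (hx t) (ha t)) hαy (by rwa [hA])
    -- The terminating form has exponent `m + 1`, so `m = N r - 1`; this uses `N r ≥ 1`.
    · refine hasSum_symTerm_terminating hq0 hq1 hb hx hgen (fun r => ⟨N r - 1, ?_⟩) hαx hαbx hαy
        hαc (by rwa [hA])
      rw [Nat.sub_add_cancel (hN r), ← haN r]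
  simp only [rogersTerm_eq_symTerm q α b hc hx ha]
  convert key using 1
  rw [symValue, hA, hY]
  congr 1
  refine prod_congr rfl fun r _ => ?_
  rw [hy]
  congr 3 <;> ring
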